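/- **Proposition 4.1.** Let $J,K\ge 1$ and, for $1\le k\le K$, let $a_k,b_k:\mathbb R_+\times\mathbb R_+^J\to\mathbb R_+$ be functions such that the $a_k$ are bounded and the $a_k$ and $b_k$ are Lipschitz. On $\mathbb R^M$ write $\|x\|=\max_{m}|x_m|$, and $\|z\|_t=\sup_{0\le s\le t}\|z(s)\|$ for a function $z:\mathbb R_+\to\mathbb R^M$. Then there is a constant $A\ge 0$, depending only on the functions $(a_k)$ and $(b_k)$, such that the following holds. Let $r_1,\dots,r_K\in(0,1)$, and let $\mathcal N_1,\dots,\mathcal N_K$ be independent Poisson point processes on $\mathbb R_+^2$ with Lebesgue intensity, defined on a probability space with a filtration $(\mathcal F_t)_{t\ge 0}$ such that, for every $t$, the points of the $\mathcal N_k$ in $\mathbb R_+\times[0,t]$ are $\mathcal F_t$-measurable and the points of the $\mathcal N_k$ in $\mathbb R_+\times(t,\infty)$ (jointly in $k$) are independent of $\mathcal F_t$. For a deterministic continuous function $u:\mathbb R_+\to\mathbb R_+^J$ and an $\mathcal F_0$-measurable $\mathbb R_+^K$-valued random variable $X_0$, let $\phi(X_0,u)=(X_k(t))$ denote any solution, that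 is, any $(\mathcal F_t)$-adapted càdlàg $\mathbb R_+^K$-valued process satisfying almost surely, for all $t\ge0$ and $1\le k\le K$, the integrated form of $$dX_k(t)=a_k(X_k(t-),u(t))\,dt-(1-r_k)X_k(t-)\int \mathbf 1_{\{0\le z\le b_k(X_k(t-),u(t))\}}\,\mathcal N_k(dz,dt),\qquad X(0)=X_0. \tag{$\mathcal E_u$}$$ Then for all such functions $u,u'$, all such random variables $X_0,X_0'$, and every $t\ge 0$, almost surely, $$\mathbb E\big[\|\phi(X_0,u)-\phi(X_0',u')\|_t\,\big|\,X_0,X_0'\big]\le\Big[\|X_0-X_0'\|+\int_0^tC(s)\,\|u-u'\|_s\,ds\Big]e^{tC(t)},$$ where $C(t)=A\,(1+t+\|u\|_t+\|X_0\|+\|X_0'\|)$. -/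

import Mathlib

open MeasureTheory ProbabilityTheory Filter Topology Set
open scoped NNReal ENNReal

namespace AIMD

/-- Lebesgue measure on `ℝ₊ = [0, ∞)`. -/
noncomputable def leb : Measure ℝ≥0 := Measure.comap (fun x : ℝ≥0 => (x : ℝ)) volume

/-- A vector of `ℝ₊^M` seen as a vector of `ℝ^M`; on `Fin M → ℝ` the norm `‖·‖` is the maximum
norm. -/
def vec {M : ℕ} (x : Fin M → ℝ≥0) : Fin M → ℝ := fun m => (x m : ℝ)

/-- `‖z‖_t = sup_{0 ≤ s ≤ t} ‖z(s)‖`. It is used for càdlàg and for continuous functions only,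
which are bounded on `[0, t]`. -/
noncomputable def supNorm {M : ℕ} (z : ℝ≥0 → Fin M → ℝ) (t : ℝ≥0) : ℝ :=
  ⨆ s : Set.Iic t, ‖z s‖

/-- A function on `ℝ₊` that is right-continuous with left limits at every point. -/
def IsCadlag {E : Type*} [TopologicalSpace E] (f : ℝ≥0 → E) : Prop :=
  ∀ t, ContinuousWithinAt f (Set.Ici t) t ∧ ∃ l, Tendsto f (𝓝[<] t) (𝓝 l)

/-- `N` is a Poisson point process (as a random counting measure) with intensity measure `ν`: the
numbers of points in sets of finite intensity are Poisson distributed, and the numbers of points in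
disjoint sets are independent. -/
structure IsPoissonProcess {Ω E : Type*} [MeasurableSpace Ω] [MeasurableSpace E]
    (N : Ω → Measure E) (ν : Measure E) (P : Measure Ω) : Prop where
  measurable : Measurable N
  law : ∀ B : Set E, MeasurableSet B → ν B ≠ ∞ →
    P.map (fun ω => N ω B) =
      (poissonMeasure (ν B).toNNReal).map (fun n : ℕ => (n : ℝ≥0∞))
  indep : ∀ (n : ℕ) (B : Fin n → Set E), (∀ i, MeasurableSet (B i)) →
    (∀ i j, i ≠ j → Disjoint (B i) (B j)) → iIndepFun (fun i ω => N ω (B i)) P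

/-- `N 1, …, N K` are independent Poisson processes on `ℝ₊²` (marks `z` in the first coordinate,
time in the second one) whose intensity is Lebesgue measure, with respect to the filtration `𝓕`:
the points up to time `t` are known at time `t`, and the points after time `t` are independent of
`𝓕 t`. -/
structure IsDrivingNoise {Ω : Type*} [mΩ : MeasurableSpace Ω] {K : ℕ}
    (N : Fin K → Ω → Measure (ℝ≥0 × ℝ≥0)) (𝓕 : Filtration ℝ≥0 mΩ) (P : Measure Ω) : Prop where
  poisson : ∀ k, IsPoissonProcess (N k) (leb.prod leb) P
  indep : iIndepFun N P
  adapted : ∀ k t, Measurable[𝓕 t] (fun ω => (N k ω).restrict (Set.univ ×ˢ Set.Iic t))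
  indep_future : ∀ t, Indep (𝓕 t)
    (⨆ k, MeasurableSpace.comap
      (fun ω => (N k ω).restrict (Set.univ ×ˢ Set.Ioi t)) inferInstance) P

/-- `X` is a solution, driven by `N` and starting at `X₀`, of
`dX_k(t) = a_k(X_k(t-), u(t)) dt - (1 - r_k) X_k(t-) ∫ 1_{0 ≤ z ≤ b_k(X_k(t-), u(t))} N_k(dz, dt)`,
that is, `X` is an adapted càdlàg process with values in `ℝ₊^K` that satisfies almost surely, for
all `t` and `k`, the integrated equation. -/
structure IsSolution {Ω : Type*} [mΩ : MeasurableSpace Ω] {J K : ℕ}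
    (a b : Fin K → ℝ≥0 × (Fin J → ℝ≥0) → ℝ≥0) (r : Fin K → ℝ)
    (N : Fin K → Ω → Measure (ℝ≥0 × ℝ≥0)) (𝓕 : Filtration ℝ≥0 mΩ) (P : Measure Ω)
    (u : ℝ≥0 → Fin J → ℝ≥0) (X₀ : Ω → Fin K → ℝ≥0) (X : ℝ≥0 → Ω → Fin K → ℝ≥0) : Prop where
  adapted : ∀ t, Measurable[𝓕 t] (X t)
  cadlag : ∀ ω, IsCadlag (fun t => X t ω)
  equation : ∀ᵐ ω ∂P, ∀ (t : ℝ≥0) (k : Fin K),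
    (X t ω k : ℝ) = X₀ ω k
      + ∫ s in Set.Ioc 0 t, (a k (Function.leftLim (fun v => X v ω k) s, u s) : ℝ) ∂leb
      - (1 - r k) * ∫ p in Set.univ ×ˢ Set.Ioc 0 t,
          {q : ℝ≥0 × ℝ≥0 | q.1 ≤ b k (Function.leftLim (fun v => X v ω k) q.2, u q.2)}.indicator
            (fun q => (Function.leftLim (fun v => X v ω k) q.2 : ℝ)) p ∂(N k ω)

/-- `C(t) = A (1 + t + ‖u‖_t + ‖x‖ + ‖x'‖)`. -/
noncomputable def growth {J K : ℕ} (A : ℝ) (u : ℝ≥0 → Fin J → ℝ≥0) (x x' : Fin K → ℝ≥0)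
    (t : ℝ≥0) : ℝ :=
  A * (1 + t + supNorm (fun s => vec (u s)) t + ‖vec x‖ + ‖vec x'‖)

end AIMD

namespace AIMD

/-! ### Lebesgue measure on the half-line -/

/-! Both solutions are driven by the same noise, so they can be compared path by path. The
difficulty is that the jump term multiplies the state by an unbounded rate, which is only locally
Lipschitz. But jumps only decrease a coordinate and the drift is bounded by some `B`, so `X_k(t) ≤
‖X₀‖ + B t` (`IsSolution.le_add_mul`). The effective Lipschitz constant is thus at most a multiple
of `y(t) = 1 + t + ‖u‖_t + ‖X₀‖ + ‖X₀'‖` (`rate_le`), which is known at time `0`.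

Subtracting the equations and putting absolute values inside the integrals bounds the running
supremum of the distance by increasing quantities (`ae_ofReal_supNorm_le`), so no martingale
inequality is needed. The jump integrands depend on left limits and are predictable. The
compensation formula `IsDrivingNoise.lintegral_lintegral_eq` therefore replaces the noise by
Lebesgue measure in the mean, also over an event `G` of `𝓕 0`. Integrating out the mark `z` turns
the difference of two indicators into the difference of two rates (`lintegral_jump_sub_le`).

If `y(t) ≤ m` on `G`, the mean distance over `G` satisfies a Gronwall inequality with rate
proportional to `m` (`meanDist_le`). A general `G` is cut along the integer part of `y(t)` and the
slices are summed (`meanDist_le_lintegral`). Letting `G` range over the events of `σ(X₀, X₀')` gives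
the conditional estimate. Lower integrals with values in `[0, ∞]` are used for means, so `X₀` need
not be integrable. -/

lemma measurableEmbedding_coe : MeasurableEmbedding (fun x : ℝ≥0 => (x : ℝ)) :=
  MeasurableEmbedding.subtype_coe measurableSet_Ici

lemma image_coe_Ioc (s t : ℝ≥0) : (fun x : ℝ≥0 => (x : ℝ)) '' Ioc s t = Ioc (s : ℝ) t := by
  ext x
  constructor
  · rintro ⟨y, hy, rfl⟩
    exact ⟨by exact_mod_cast hy.1, by exact_mod_cast hy.2⟩
  · rintro ⟨h1, h2⟩
    have h0 : 0 ≤ x := s.2.trans h1.le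
    exact ⟨⟨x, h0⟩, ⟨h1, h2⟩, rfl⟩

lemma leb_Ioc (s t : ℝ≥0) : leb (Ioc s t) = (t - s : ℝ≥0) := by
  rw [leb, measurableEmbedding_coe.comap_apply, image_coe_Ioc, Real.volume_Ioc, ENNReal.ofReal,
    ENNReal.coe_inj]
  exact NNReal.eq (by rw [NNReal.sub_def])

lemma leb_Iic (t : ℝ≥0) : leb (Iic t) = t := by
  have h : (fun x : ℝ≥0 => (x : ℝ)) '' Iic t = Icc (0 : ℝ) t := by
    ext x
    constructor
    · rintro ⟨y, hy, rfl⟩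
      exact ⟨y.2, by exact_mod_cast hy⟩
    · rintro ⟨h1, h2⟩
      exact ⟨⟨x, h1⟩, h2, rfl⟩
  rw [leb, measurableEmbedding_coe.comap_apply, h, Real.volume_Icc]
  simp

instance : SigmaFinite leb := by
  refine ⟨⟨⟨fun n : ℕ => Iic (n : ℝ≥0), fun _ => trivial, fun n => ?_, ?_⟩⟩⟩
  · rw [leb_Iic]; exact ENNReal.coe_lt_top
  · exact iUnion_eq_univ_iff.2 fun x => exists_nat_ge x

lemma lintegral_leb_Ioc (t : ℝ≥0) (f : ℝ → ℝ≥0∞) :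
    ∫⁻ s in Ioc 0 t, f s ∂leb = ∫⁻ s in Ioc (0 : ℝ) t, f s := by
  have h := measurableEmbedding_coe.lintegral_map
    (μ := leb.restrict (Ioc 0 t)) f
  rw [← h, leb]
  congr 1
  rw [← NNReal.coe_zero, ← image_coe_Ioc]
  ext A hA
  rw [measurableEmbedding_coe.map_apply,
    Measure.restrict_apply (measurableEmbedding_coe.measurable hA),
    measurableEmbedding_coe.comap_apply, Measure.restrict_apply hA, image_preimage_inter]

lemma lintegral_exp_leb {c : ℝ} (hc : 0 < c) (t : ℝ≥0) :
    ∫⁻ s in Ioc 0 t, ENNReal.ofReal (Real.exp (c * s)) ∂leb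
      = ENNReal.ofReal ((Real.exp (c * t) - 1) / c) := by
  rw [lintegral_leb_Ioc t (fun s => ENNReal.ofReal (Real.exp (c * s))),
    ← ofReal_integral_eq_lintegral_ofReal]
  · congr 1
    rw [← intervalIntegral.integral_of_le (NNReal.coe_nonneg t),
      intervalIntegral.integral_comp_mul_left _ hc.ne']
    simp
    field_simp
  · have : Continuous fun s : ℝ => Real.exp (c * s) := by fun_prop
    exact (this.integrableOn_Icc (a := 0) (b := (t : ℝ))).mono_set Ioc_subset_Icc_self
  · exact ae_of_all _ fun s => (Real.exp_pos _).le

/-- A form of Gronwall's inequality that needs no measurability. -/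
lemma gronwall {Φ : ℝ≥0 → ℝ≥0∞} {α M : ℝ≥0∞} {c : ℝ} {t : ℝ≥0} (hc : 0 < c) (hM : M ≠ ∞)
    (hb : ∀ s ≤ t, Φ s ≤ M)
    (h : ∀ s ≤ t, Φ s ≤ α + ENNReal.ofReal c * ∫⁻ v in Ioc 0 s, Φ v ∂leb) :
    Φ t ≤ α * ENNReal.ofReal (Real.exp (2 * c * t)) := by
  set e : ℝ≥0 → ℝ≥0∞ := fun s => ENNReal.ofReal (Real.exp (2 * c * s)) with he
  have he1 : ∀ s, 1 ≤ e s := fun s => by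
    rw [he, ← ENNReal.ofReal_one]
    exact ENNReal.ofReal_le_ofReal (Real.one_le_exp (by positivity))
  have he0 : ∀ s, e s ≠ 0 := fun s => (zero_lt_one.trans_le (he1 s)).ne'
  have het : ∀ s, e s ≠ ∞ := fun s => ENNReal.ofReal_ne_top
  -- The best constant in `Φ ≤ m e`. Doubling the exponent makes the integral term contribute only
  -- `m / 2`, so that `m ≤ max α (m / 2)`; as `m` is finite, this forces `m ≤ α`. Only monotonicity
  -- of the integral is applied to `Φ`.
  set m : ℝ≥0∞ := ⨆ s : Iic t, Φ s / e s with hm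
  have hΦ : ∀ s ≤ t, Φ s ≤ m * e s := fun s hs => by
    rw [← ENNReal.div_le_iff (he0 s) (het s)]
    exact le_iSup (fun s : Iic t => Φ s / e s) ⟨s, hs⟩
  have hmM : m ≤ M := iSup_le fun s => by
    refine (ENNReal.div_le_of_le_mul ?_)
    calc Φ s ≤ M * 1 := by simpa using hb s s.2
      _ ≤ M * e s := by gcongr; exact he1 s
  have hmt : m ≠ ∞ := ne_top_of_le_ne_top hM hmM
  have key : ∀ s ≤ t, Φ s ≤ α + m / 2 * (e s - 1) := fun s hs => by
    have h1 : ∫⁻ v in Ioc 0 s, Φ v ∂leb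
        ≤ m * ENNReal.ofReal ((Real.exp (2 * c * s) - 1) / (2 * c)) := by
      rw [← lintegral_exp_leb (by positivity), ← lintegral_const_mul' _ _ hmt]
      refine setLIntegral_mono' measurableSet_Ioc fun v hv => hΦ v (hv.2.trans hs)
    refine (h s hs).trans (add_le_add le_rfl ?_)
    calc ENNReal.ofReal c * ∫⁻ v in Ioc 0 s, Φ v ∂leb
        ≤ ENNReal.ofReal c * (m * ENNReal.ofReal ((Real.exp (2 * c * s) - 1) / (2 * c))) := by gcongr
      _ = m * ENNReal.ofReal ((1 / 2) * (Real.exp (2 * c * s) - 1)) := by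
        rw [mul_left_comm, ← ENNReal.ofReal_mul hc.le]
        congr 2
        field_simp
      _ = m / 2 * (e s - 1) := by
        rw [ENNReal.ofReal_mul (by norm_num), ENNReal.ofReal_sub _ zero_le_one, ENNReal.ofReal_one,
          ← mul_assoc]
        congr 1
        rw [one_div, ENNReal.ofReal_inv_of_pos (by norm_num), ENNReal.div_eq_inv_mul, mul_comm]
        simp
  have hle : m ≤ max α (m / 2) := iSup_le fun s => by
    refine ENNReal.div_le_of_le_mul ((key s s.2).trans ?_)
    calc α + m / 2 * (e s - 1) ≤ max α (m / 2) * 1 + max α (m / 2) * (e s - 1) := by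
          rw [mul_one]; gcongr
          · exact le_max_left _ _
          · exact le_max_right _ _
      _ = max α (m / 2) * e s := by rw [← mul_add, add_tsub_cancel_of_le (he1 s)]
  have hmα : m ≤ α := by
    rcases le_max_iff.1 hle with h1 | h1
    · exact h1
    · rcases eq_or_ne m 0 with h0 | h0
      · simp [h0]
      · exact absurd h1 (not_le.2 (ENNReal.half_lt_self h0 hmt))
  exact (hΦ t le_rfl).trans (by gcongr)

/-! ### Means of Poisson variables -/

/-- The weights `p` satisfy `(n + 1) p(n + 1) = r p(n)`, and the `p(n)` sum to `1`. -/
lemma lintegral_poissonMeasure (r : ℝ≥0) :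
    ∫⁻ n, (n : ℝ≥0∞) ∂(poissonMeasure r) = r := by
  rw [poissonMeasure, lintegral_sum_measure]
  simp only [lintegral_smul_measure, lintegral_dirac, smul_eq_mul]
  rw [tsum_eq_zero_add' ENNReal.summable]
  have h : ∀ n : ℕ, ENNReal.ofReal (Real.exp (-r) * r ^ (n + 1) / (n + 1).factorial)
      * ((n + 1 : ℕ) : ℝ≥0∞) = r * ENNReal.ofReal (Real.exp (-r) * r ^ n / n.factorial) := by
    intro n
    rw [← ENNReal.ofReal_natCast, ← ENNReal.ofReal_mul (by positivity), ← ENNReal.ofReal_coe_nnreal,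
      ← ENNReal.ofReal_mul (by positivity)]
    congr 1
    rw [Nat.factorial_succ]
    push_cast
    field_simp
    ring
  simp only [h, ENNReal.tsum_mul_left]
  rw [← ENNReal.ofReal_tsum_of_nonneg (fun n => by positivity)
    (hasSum_one_poissonMeasure r).summable, (hasSum_one_poissonMeasure r).tsum_eq]
  simp

lemma IsPoissonProcess.lintegral_eq {Ω E : Type*} [MeasurableSpace Ω] [MeasurableSpace E]
    {N : Ω → Measure E} {ν : Measure E} {P : Measure Ω} (h : IsPoissonProcess N ν P)
    {B : Set E} (hB : MeasurableSet B) (hν : ν B ≠ ∞) : ∫⁻ ω, N ω B ∂P = ν B := by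
  have h1 : Measurable fun ω => N ω B := (Measure.measurable_coe hB).comp h.measurable
  have h2 := lintegral_map (μ := P) (f := fun x : ℝ≥0∞ => x) measurable_id h1
  rw [← h2, h.law B hB hν, lintegral_map (f := fun x : ℝ≥0∞ => x) measurable_id (by fun_prop),
    lintegral_poissonMeasure,
    ENNReal.coe_toNNReal hν]

/-! ### The predictable σ-algebra of marked processes -/

section Predictable

variable {Ω : Type*} [mΩ : MeasurableSpace Ω] (𝓕 : Filtration ℝ≥0 mΩ)

/-- The sets `F × B × (s, ∞)`, `F ∈ 𝓕 s`, and `F × B × [0, ∞)`, `F ∈ 𝓕 0`, with `B` of finite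
Lebesgue measure. -/
def predictableRectangles : Set (Set (Ω × (ℝ≥0 × ℝ≥0))) :=
  {A | ∃ (s : ℝ≥0) (I : Set ℝ≥0) (F : Set Ω) (B : Set ℝ≥0), (I = Ioi s ∨ (s = 0 ∧ I = univ)) ∧
    MeasurableSet[𝓕 s] F ∧ MeasurableSet B ∧ leb B ≠ ∞ ∧ A = F ×ˢ (B ×ˢ I)}

/-- The σ-algebra of predictable events depending on a mark. -/
@[reducible] def markedPredictable : MeasurableSpace (Ω × (ℝ≥0 × ℝ≥0)) :=
  MeasurableSpace.generateFrom (predictableRectangles 𝓕)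

lemma isPiSystem_predictableRectangles : IsPiSystem (predictableRectangles 𝓕) := by
  rintro _ ⟨s, I, F, B, hI, hF, hB, hB', rfl⟩ _ ⟨s', I', F', B', hI', hF', hC, hC', rfl⟩ -
  refine ⟨max s s', I ∩ I', F ∩ F', B ∩ B', ?_, ?_, hB.inter hC,
    measure_ne_top_of_subset inter_subset_left hB', ?_⟩
  · rcases hI with rfl | ⟨rfl, rfl⟩ <;> rcases hI' with rfl | ⟨rfl, rfl⟩
    · left; exact Ioi_inter_Ioi
    · left; simp
    · left; simp
    · right; simp
  · exact (𝓕.mono (le_max_left s s') _ hF).inter (𝓕.mono (le_max_right s s') _ hF')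
  · rw [prod_inter_prod, prod_inter_prod]

lemma markedPredictable_le : markedPredictable 𝓕 ≤
    (inferInstance : MeasurableSpace (Ω × (ℝ≥0 × ℝ≥0))) := by
  refine MeasurableSpace.generateFrom_le ?_
  rintro _ ⟨s, I, F, B, hI, hF, hB, -, rfl⟩
  refine (𝓕.le s _ hF).prod (hB.prod ?_)
  rcases hI with rfl | ⟨-, rfl⟩
  · exact measurableSet_Ioi
  · exact MeasurableSet.univ

variable {𝓕}

/-- Generators have mark sets of finite measure so that the measures compared in the compensation
formula are finite on them; a countable union removes this restriction. -/
lemma measurableSet_markedPredictable {s : ℝ≥0} {I : Set ℝ≥0} {F : Set Ω} {B : Set ℝ≥0}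
    (hI : I = Ioi s ∨ (s = 0 ∧ I = univ)) (hF : MeasurableSet[𝓕 s] F) (hB : MeasurableSet B) :
    MeasurableSet[markedPredictable 𝓕] (F ×ˢ (B ×ˢ I)) := by
  have h : F ×ˢ (B ×ˢ I) = ⋃ n : ℕ, F ×ˢ ((B ∩ Iic (n : ℝ≥0)) ×ˢ I) := by
    ext ⟨ω, z, v⟩
    simp only [mem_prod, mem_iUnion, mem_inter_iff, mem_Iic]
    constructor
    · rintro ⟨h1, h2, h3⟩
      obtain ⟨n, hn⟩ := exists_nat_ge z
      exact ⟨n, h1, ⟨h2, hn⟩, h3⟩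
    · rintro ⟨n, h1, ⟨h2, hn⟩, h3⟩
      exact ⟨h1, h2, h3⟩
  rw [h]
  refine MeasurableSet.iUnion fun n => MeasurableSpace.measurableSet_generateFrom
    ⟨s, I, F, _, hI, hF, hB.inter measurableSet_Iic, ?_, rfl⟩
  refine measure_ne_top_of_subset inter_subset_right ?_
  rw [leb_Iic]
  exact ENNReal.coe_ne_top

lemma measurable_mark : Measurable[markedPredictable 𝓕] fun p : Ω × (ℝ≥0 × ℝ≥0) => p.2.1 := by
  intro B hB
  convert! measurableSet_markedPredictable (𝓕 := 𝓕) (Or.inr ⟨rfl, rfl⟩) MeasurableSet.univ hB using 1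
  ext ⟨ω, z, v⟩
  simp

lemma measurable_time : Measurable[markedPredictable 𝓕] fun p : Ω × (ℝ≥0 × ℝ≥0) => p.2.2 := by
  refine measurable_of_Ioi fun s => ?_
  convert! measurableSet_markedPredictable (𝓕 := 𝓕) (s := s) (Or.inl rfl) MeasurableSet.univ
    MeasurableSet.univ using 1
  ext ⟨ω, z, v⟩
  simp

/-- The last point of `ℕ / (n + 1)` strictly before `s` (and `0` for `s = 0`). -/
noncomputable def gridIndex (n : ℕ) (s : ℝ≥0) : ℕ := ⌈(n + 1) * s⌉₊ - 1

lemma gridIndex_lt {n : ℕ} {s : ℝ≥0} (hs : 0 < s) : (gridIndex n s : ℝ≥0) / (n + 1) < s := by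
  have hpos : 0 < ⌈((n : ℝ≥0) + 1) * s⌉₊ := Nat.ceil_pos.2 (by positivity)
  rw [div_lt_iff₀ (by positivity), mul_comm s]
  refine Nat.lt_ceil.1 ?_
  rw [gridIndex]
  omega

lemma le_gridIndex (n : ℕ) (s : ℝ≥0) : s ≤ ((gridIndex n s : ℝ≥0) + 1) / (n + 1) := by
  rw [le_div_iff₀ (by positivity), mul_comm s]
  refine (Nat.le_ceil _).trans ?_
  rw [gridIndex]
  exact_mod_cast (by omega : ⌈((n : ℝ≥0) + 1) * s⌉₊ ≤ ⌈((n : ℝ≥0) + 1) * s⌉₊ - 1 + 1)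

lemma tendsto_grid {s : ℝ≥0} (hs : 0 < s) :
    Tendsto (fun n : ℕ => (gridIndex n s : ℝ≥0) / (n + 1)) atTop (𝓝[<] s) := by
  refine tendsto_nhdsWithin_iff.2 ⟨?_, Eventually.of_forall fun n => gridIndex_lt hs⟩
  have h : Tendsto (fun n : ℕ => (s : ℝ) - 1 / ((n : ℝ) + 1)) atTop (𝓝 (s - 0)) :=
    tendsto_const_nhds.sub tendsto_one_div_add_atTop_nhds_zero_nat
  rw [sub_zero] at h
  rw [← NNReal.tendsto_coe]
  refine tendsto_of_tendsto_of_tendsto_of_le_of_le h tendsto_const_nhds (fun n => ?_)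
    fun n => by exact_mod_cast (gridIndex_lt hs).le
  have := NNReal.coe_le_coe.2 (le_gridIndex n s)
  push_cast at this ⊢
  rw [add_div] at this
  linarith

lemma nhdsLT_neBot {s : ℝ≥0} (hs : 0 < s) : (𝓝[<] s).NeBot :=
  (tendsto_grid hs).neBot

lemma IsCadlag.tendsto_leftLim {K : ℕ} {x : ℝ≥0 → Fin K → ℝ≥0} (hx : IsCadlag x) (k : Fin K)
    (s : ℝ≥0) : Tendsto (fun v => x v k) (𝓝[<] s) (𝓝 (Function.leftLim (fun v => x v k) s)) := by
  obtain ⟨l, hl⟩ := (hx s).2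
  exact tendsto_leftLim_of_tendsto ⟨l k, (tendsto_pi_nhds.1 hl) k⟩

/-- The left limits of an adapted càdlàg process are predictable. -/
lemma measurable_leftLim {K : ℕ} {X : ℝ≥0 → Ω → Fin K → ℝ≥0} (hX : ∀ t, Measurable[𝓕 t] (X t))
    (hc : ∀ ω, IsCadlag fun t => X t ω) (k : Fin K) :
    Measurable[markedPredictable 𝓕] fun p : Ω × (ℝ≥0 × ℝ≥0) =>
      Function.leftLim (fun v => X v p.1 k) p.2.2 := by
  -- The left limit at `s` is the limit of the values at the last grid points strictly before `s`.
  refine @measurable_of_tendsto_metrizable _ _ (markedPredictable 𝓕) _ _ _ _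
    (f := fun (n : ℕ) p => X ((gridIndex n p.2.2 : ℝ≥0) / (n + 1)) p.1 k) _ (fun n => ?_) ?_
  · intro V hV
    have hg : Measurable[markedPredictable 𝓕]
        fun p : Ω × (ℝ≥0 × ℝ≥0) => gridIndex n p.2.2 := by
      have : Measurable (gridIndex n) :=
        (measurable_from_top (f := fun m : ℕ => m - 1)).comp
          (Nat.measurable_ceil.comp (measurable_const_mul _))
      exact this.comp measurable_time
    -- Where the grid index is `j`, the value is known at time `j / (n + 1)`, which is strictly
    -- before `s` unless `j = 0`: each piece is a predictable rectangle cut by a condition on time.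
    have hset : (fun p : Ω × (ℝ≥0 × ℝ≥0) => X ((gridIndex n p.2.2 : ℝ≥0) / (n + 1)) p.1 k) ⁻¹' V
        = ⋃ j : ℕ, (fun p : Ω × (ℝ≥0 × ℝ≥0) => gridIndex n p.2.2) ⁻¹' {j} ∩
          ((fun ω => X ((j : ℝ≥0) / (n + 1)) ω k) ⁻¹' V) ×ˢ
            (univ ×ˢ (if j = 0 then univ else Ioi ((j : ℝ≥0) / (n + 1)))) := by
      ext ⟨ω, z, v⟩
      simp only [mem_preimage, mem_iUnion, mem_inter_iff, mem_singleton_iff, mem_prod, mem_univ,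
        true_and]
      constructor
      · intro h
        refine ⟨_, rfl, h, ?_⟩
        split_ifs with h0
        · trivial
        · refine gridIndex_lt (pos_iff_ne_zero.2 ?_)
          rintro rfl
          exact h0 (by simp [gridIndex])
      · rintro ⟨j, rfl, h, -⟩
        exact h
    rw [hset]
    refine MeasurableSet.iUnion fun j => (hg (measurableSet_singleton j)).inter
      (measurableSet_markedPredictable (s := (j : ℝ≥0) / (n + 1)) ?_
        (((measurable_pi_apply k).comp (hX _)) hV) MeasurableSet.univ)
    split_ifs with h0
    · right; simp [h0]
    · left; rfl
  · rw [tendsto_pi_nhds]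
    rintro ⟨ω, z, s⟩
    -- At time `0` nothing lies to the left: `leftLim` is by convention the value there, and the
    -- grid point is `0` too.
    rcases eq_or_ne s 0 with rfl | hs
    · rw [leftLim_eq_of_isBot fun x => zero_le]
      simp [gridIndex]
    · exact ((hc ω).tendsto_leftLim k s).comp (tendsto_grid (pos_iff_ne_zero.2 hs))

end Predictable

/-! ### The compensation formula -/

/-- Cutting the source along the integer part `n` of the total mass gives countably many kernels,
the `n`-th of mass at most `n + 1`. -/
lemma isSFiniteKernel_of_isFiniteMeasure {α β : Type*} [MeasurableSpace α] [MeasurableSpace β]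
    (κ : Kernel α β) (h : ∀ a, κ a univ ≠ ∞) : IsSFiniteKernel κ := by
  classical
  have hm : Measurable fun a => ⌊(κ a univ).toNNReal⌋₊ :=
    Nat.measurable_floor.comp (κ.measurable_coe MeasurableSet.univ).ennreal_toNNReal
  have hs : ∀ n : ℕ, MeasurableSet {a | ⌊(κ a univ).toNNReal⌋₊ = n} := fun n =>
    hm (measurableSet_singleton n)
  refine ⟨⟨fun n => Kernel.piecewise (hs n) κ 0, fun n => ⟨⟨n + 1, by finiteness, fun a => ?_⟩⟩, ?_⟩⟩
  · rw [Kernel.piecewise_apply]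
    split_ifs with ha
    · have h1 := (Nat.lt_floor_add_one (κ a univ).toNNReal).le
      rw [show ⌊(κ a univ).toNNReal⌋₊ = n from ha] at h1
      rw [← ENNReal.coe_toNNReal (h a)]
      exact_mod_cast h1
    · simp
  · ext a s hsm
    rw [Kernel.sum_apply' _ _ hsm, tsum_eq_single ⌊(κ a univ).toNNReal⌋₊]
    · rw [Kernel.piecewise_apply, if_pos]
      rfl
    · intro n hn
      rw [Kernel.piecewise_apply, if_neg]
      · simp
      · exact fun h => hn h.symm

lemma isSFiniteKernel_of_iUnion {α β : Type*} [MeasurableSpace α] [MeasurableSpace β]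
    (κ : Kernel α β) {B : ℕ → Set β} (hB : ∀ n, MeasurableSet (B n)) (hU : ⋃ n, B n = univ)
    (h : ∀ a n, κ a (B n) ≠ ∞) : IsSFiniteKernel κ := by
  have hd : ∀ n, MeasurableSet (disjointed B n) := fun n => MeasurableSet.disjointed hB n
  have hk : ∀ n, IsSFiniteKernel (κ.restrict (hd n)) := fun n => by
    refine isSFiniteKernel_of_isFiniteMeasure _ fun a => ?_
    rw [Kernel.restrict_apply, Measure.restrict_apply_univ]
    exact measure_ne_top_of_subset (disjointed_subset B n) (h a n)
  have : κ = Kernel.sum fun n => κ.restrict (hd n) := by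
    ext a s hs
    rw [Kernel.sum_apply' _ _ hs]
    simp only [Kernel.restrict_apply, Measure.restrict_apply hs]
    rw [← measure_iUnion, ← inter_iUnion, iUnion_disjointed, hU, inter_univ]
    · exact fun i j hij => (disjoint_disjointed B hij).mono inter_subset_right inter_subset_right
    · exact fun n => hs.inter (hd n)
  rw [this]
  exact Kernel.isSFiniteKernel_sum

section Compensation

variable {Ω : Type*} [mΩ : MeasurableSpace Ω] {P : Measure Ω} {𝓕 : Filtration ℝ≥0 mΩ}
  {K : ℕ} {N : Fin K → Ω → Measure (ℝ≥0 × ℝ≥0)}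

lemma leb_prod_Ioc_ne_top {B : Set ℝ≥0} (hB : leb B ≠ ∞) (s t : ℝ≥0) :
    (leb.prod leb) (B ×ˢ Ioc s t) ≠ ∞ := by
  rw [Measure.prod_prod, leb_Ioc]
  exact ENNReal.mul_ne_top hB ENNReal.coe_ne_top

lemma IsDrivingNoise.ae_ne_top (h : IsDrivingNoise N 𝓕 P) (k : Fin K) :
    ∀ᵐ ω ∂P, ∀ n m : ℕ, N k ω (Iic (n : ℝ≥0) ×ˢ Ioc 0 (m : ℝ≥0)) ≠ ∞ := by
  refine ae_all_iff.2 fun n => ae_all_iff.2 fun m => ?_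
  have hB : MeasurableSet (Iic (n : ℝ≥0) ×ˢ Ioc 0 (m : ℝ≥0)) :=
    measurableSet_Iic.prod measurableSet_Ioc
  have hf : (leb.prod leb) (Iic (n : ℝ≥0) ×ˢ Ioc 0 (m : ℝ≥0)) ≠ ∞ :=
    leb_prod_Ioc_ne_top (by rw [leb_Iic]; exact ENNReal.coe_ne_top) _ _
  have := ae_lt_top ((Measure.measurable_coe hB).comp (h.poisson k).measurable)
    (((h.poisson k).lintegral_eq hB hf).trans_ne hf)
  exact this.mono fun ω hω => hω.ne

/-- The compensation formula on rectangles: the count is a function of the points after time `s`,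
hence independent of `F`, and its mean is the intensity. -/
lemma IsDrivingNoise.setLIntegral_eq (h : IsDrivingNoise N 𝓕 P) (k : Fin K) {s t : ℝ≥0}
    {F : Set Ω} (hF : MeasurableSet[𝓕 s] F) {B : Set ℝ≥0} (hB : MeasurableSet B)
    (hB' : leb B ≠ ∞) :
    ∫⁻ ω in F, N k ω (B ×ˢ Ioc s t) ∂P = P F * (leb.prod leb) (B ×ˢ Ioc s t) := by
  have hBt : MeasurableSet (B ×ˢ Ioc s t) := hB.prod measurableSet_Ioc
  set g : Ω → ℝ≥0∞ := fun ω => (N k ω).restrict (univ ×ˢ Ioi s) (B ×ˢ Ioc s t) with hg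
  have hNg : ∀ ω, N k ω (B ×ˢ Ioc s t) = g ω := fun ω => by
    rw [hg]
    simp only
    rw [Measure.restrict_apply hBt, inter_eq_self_of_subset_left]
    exact prod_mono (subset_univ _) Ioc_subset_Ioi_self
  have hmeas : ∀ k, Measurable fun ω => (N k ω).restrict (univ ×ˢ Ioi s) := fun k =>
    Measure.measurable_of_measurable_coe _ fun A hA => by
      simp only [Measure.restrict_apply hA]
      exact (Measure.measurable_coe
        (hA.inter (MeasurableSet.univ.prod measurableSet_Ioi))).comp (h.poisson k).measurable
  have hle : (⨆ k, MeasurableSpace.comap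
      (fun ω => (N k ω).restrict (Set.univ ×ˢ Set.Ioi s)) inferInstance) ≤ mΩ :=
    iSup_le fun k => (hmeas k).comap_le
  have hgm : Measurable[⨆ k, MeasurableSpace.comap
      (fun ω => (N k ω).restrict (Set.univ ×ˢ Set.Ioi s)) inferInstance] g := by
    refine (Measure.measurable_coe hBt).comp ?_
    exact (comap_measurable _).mono (le_iSup (fun k => MeasurableSpace.comap
      (fun ω => (N k ω).restrict (Set.univ ×ˢ Set.Ioi s)) inferInstance) k) le_rfl
  have key := lintegral_mul_eq_lintegral_mul_lintegral_of_independent_measurableSpace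
    (𝓕.le s) hle (h.indep_future s)
    (f := F.indicator fun _ => 1) (measurable_const.indicator hF) hgm
  rw [lintegral_indicator_const (𝓕.le s _ hF), one_mul] at key
  simp only [hNg]
  rw [← lintegral_indicator (𝓕.le s _ hF)]
  calc ∫⁻ ω, F.indicator g ω ∂P = ∫⁻ ω, F.indicator (fun _ => 1) ω * g ω ∂P := by
        congr with ω
        by_cases hω : ω ∈ F <;> simp [hω]
    _ = P F * ∫⁻ ω, g ω ∂P := key
    _ = _ := by
        simp only [← hNg]
        rw [(h.poisson k).lintegral_eq hBt (leb_prod_Ioc_ne_top hB' _ _)]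

/-- The compensation formula: for a predictable `H`, the mean of the integral of `H` against the
noise, which is a random variable, is the mean of its integral against the intensity. -/
theorem IsDrivingNoise.lintegral_lintegral_eq [IsProbabilityMeasure P] (h : IsDrivingNoise N 𝓕 P)
    (k : Fin K) {H : Ω × (ℝ≥0 × ℝ≥0) → ℝ≥0∞} (hH : Measurable[markedPredictable 𝓕] H) (t : ℝ≥0) :
    AEMeasurable (fun ω => ∫⁻ p in univ ×ˢ Ioc 0 t, H (ω, p) ∂(N k ω)) P ∧
    ∫⁻ ω, ∫⁻ p in univ ×ˢ Ioc 0 t, H (ω, p) ∂(N k ω) ∂P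
      = ∫⁻ ω, ∫⁻ p in univ ×ˢ Ioc 0 t, H (ω, p) ∂(leb.prod leb) ∂P := by
  classical
  have hT : MeasurableSet ((univ : Set ℝ≥0) ×ˢ Ioc 0 t) := MeasurableSet.univ.prod measurableSet_Ioc
  set R : ℕ → Set (ℝ≥0 × ℝ≥0) := fun n => Iic (n : ℝ≥0) ×ˢ Ioc 0 t with hR
  have hRm : ∀ n, MeasurableSet (R n) := fun n => measurableSet_Iic.prod measurableSet_Ioc
  have hNm : ∀ n, Measurable fun ω => N k ω (R n) := fun n =>
    (Measure.measurable_coe (hRm n)).comp (h.poisson k).measurable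
  set Ω₀ : Set Ω := {ω | ∀ n, N k ω (R n) ≠ ∞} with hΩ₀
  have hΩm : MeasurableSet Ω₀ := by
    rw [hΩ₀, ofPred_forall]
    exact MeasurableSet.iInter fun n => (hNm n (measurableSet_singleton ∞)).compl
  have hΩae : ∀ᵐ ω ∂P, ω ∈ Ω₀ := by
    filter_upwards [h.ae_ne_top k] with ω hω n
    obtain ⟨m, hm⟩ := exists_nat_ge t
    exact measure_ne_top_of_subset (prod_mono le_rfl (Ioc_subset_Ioc_right hm)) (hω n m)
  set κ₀ : Kernel Ω (ℝ≥0 × ℝ≥0) := ⟨N k, (h.poisson k).measurable⟩ with hκ₀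
  -- The noise is set to `0` on the null event where some bounded box carries infinite mass. This
  -- makes the kernel s-finite everywhere, as the composition-product requires.
  set κ : Kernel Ω (ℝ≥0 × ℝ≥0) := Kernel.piecewise hΩm (κ₀.restrict hT) 0 with hκ
  have hκN : ∀ᵐ ω ∂P, κ ω = (N k ω).restrict (univ ×ˢ Ioc 0 t) := by
    filter_upwards [hΩae] with ω hω
    rw [hκ, Kernel.piecewise_apply, if_pos hω, Kernel.restrict_apply]
    rfl
  have hU : ⋃ n : ℕ, Iic (n : ℝ≥0) = univ := iUnion_eq_univ_iff.2 fun x => exists_nat_ge x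
  have hsf : IsSFiniteKernel κ := by
    refine isSFiniteKernel_of_iUnion κ (B := fun n : ℕ => Iic (n : ℝ≥0) ×ˢ univ)
      (fun n => measurableSet_Iic.prod MeasurableSet.univ) ?_ fun ω n => ?_
    · rw [← iUnion_prod_const, hU, univ_prod_univ]
    · rw [hκ, Kernel.piecewise_apply]
      split_ifs with hω
      · rw [Kernel.restrict_apply, Measure.restrict_apply (measurableSet_Iic.prod MeasurableSet.univ),
          prod_inter_prod, inter_univ, univ_inter]
        exact hω n
      · simp
  set ν : Measure (ℝ≥0 × ℝ≥0) := (leb.prod leb).restrict (univ ×ˢ Ioc 0 t) with hν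
  have hle := markedPredictable_le 𝓕
  have hrect : ∀ A ∈ predictableRectangles 𝓕, (P ⊗ₘ κ) A = (P.prod ν) A ∧ (P.prod ν) A ≠ ∞ := by
    rintro _ ⟨s, I, F, B, hI, hF, hB, hB', rfl⟩
    have hF' := 𝓕.le s _ hF
    have hIm : MeasurableSet I := by
      rcases hI with rfl | ⟨-, rfl⟩
      · exact measurableSet_Ioi
      · exact MeasurableSet.univ
    -- Time `0` is excluded from the integrals, so both kinds of generators leave the same window.
    have hIt : I ∩ Ioc 0 t = Ioc s t := by
      rcases hI with rfl | ⟨rfl, rfl⟩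
      · ext v
        simp only [mem_inter_iff, mem_Ioi, mem_Ioc]
        exact ⟨fun h => ⟨h.1, h.2.2⟩, fun h => ⟨h.1, zero_le.trans_lt h.1, h.2⟩⟩
      · simp
    have hBI : (B ×ˢ I) ∩ (univ ×ˢ Ioc 0 t) = B ×ˢ Ioc s t := by
      rw [prod_inter_prod, inter_univ, hIt]
    have e2 : (P.prod ν) (F ×ˢ (B ×ˢ I)) = P F * (leb.prod leb) (B ×ˢ Ioc s t) := by
      rw [Measure.prod_prod, hν, Measure.restrict_apply (hB.prod hIm), hBI]
    have e1 : (P ⊗ₘ κ) (F ×ˢ (B ×ˢ I)) = P F * (leb.prod leb) (B ×ˢ Ioc s t) := by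
      rw [Measure.compProd_apply_prod hF' (hB.prod hIm), ← h.setLIntegral_eq k hF hB hB']
      refine lintegral_congr_ae (ae_restrict_of_ae ?_)
      filter_upwards [hκN] with ω hω
      rw [hω, Measure.restrict_apply (hB.prod hIm), hBI]
    refine ⟨e1.trans e2.symm, ?_⟩
    rw [e2]
    exact ENNReal.mul_ne_top (measure_ne_top P F) (leb_prod_Ioc_ne_top hB' s t)
  have hBn : ∀ n : ℕ, (univ : Set Ω) ×ˢ (Iic (n : ℝ≥0) ×ˢ (univ : Set ℝ≥0))
      ∈ predictableRectangles 𝓕 := fun n =>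
    ⟨0, univ, univ, Iic n, Or.inr ⟨rfl, rfl⟩, MeasurableSet.univ, measurableSet_Iic,
      by rw [leb_Iic]; exact ENNReal.coe_ne_top, rfl⟩
  have hgen : ∀ A ∈ predictableRectangles 𝓕, MeasurableSet[markedPredictable 𝓕] A := fun A hA =>
    MeasurableSpace.measurableSet_generateFrom hA
  -- The two measures agree and are finite on a generating π-system containing an exhausting
  -- sequence, hence agree on all predictable events.
  have heq : (P ⊗ₘ κ).trim hle = (P.prod ν).trim hle := by
    refine @Measure.ext_of_generateFrom_of_iUnion _ (markedPredictable 𝓕) _ _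
      (predictableRectangles 𝓕) (fun n : ℕ => univ ×ˢ (Iic (n : ℝ≥0) ×ˢ univ)) rfl
      (isPiSystem_predictableRectangles 𝓕) ?_ hBn (fun n => ?_) (fun A hA => ?_)
    · rw [← prod_iUnion, ← iUnion_prod_const, hU, univ_prod_univ, univ_prod_univ]
    · rw [trim_measurableSet_eq hle (hgen _ (hBn n)), (hrect _ (hBn n)).1]
      exact (hrect _ (hBn n)).2
    · rw [trim_measurableSet_eq hle (hgen _ hA), trim_measurableSet_eq hle (hgen _ hA), (hrect _ hA).1]
  have hHm : Measurable H := hH.mono hle le_rfl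
  refine ⟨⟨fun ω => ∫⁻ p, H (ω, p) ∂(κ ω), hHm.lintegral_kernel_prod_right', ?_⟩, ?_⟩
  · filter_upwards [hκN] with ω hω
    rw [hω]
  calc ∫⁻ ω, ∫⁻ p in univ ×ˢ Ioc 0 t, H (ω, p) ∂(N k ω) ∂P
      = ∫⁻ ω, ∫⁻ p, H (ω, p) ∂(κ ω) ∂P := by
        refine lintegral_congr_ae ?_
        filter_upwards [hκN] with ω hω
        rw [hω]
    _ = ∫⁻ q, H q ∂(P ⊗ₘ κ) := (Measure.lintegral_compProd hHm).symm
    _ = ∫⁻ q, H q ∂(P.prod ν) := by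
        rw [← lintegral_trim hle hH, heq, lintegral_trim hle hH]
    _ = _ := lintegral_prod _ hHm.aemeasurable

/-- An event of `𝓕 0`, seen as a set of triples, is predictable, so its indicator can be absorbed in
`H`. -/
lemma IsDrivingNoise.setLIntegral_lintegral_eq [IsProbabilityMeasure P] (h : IsDrivingNoise N 𝓕 P)
    (k : Fin K) {H : Ω × (ℝ≥0 × ℝ≥0) → ℝ≥0∞} (hH : Measurable[markedPredictable 𝓕] H) (t : ℝ≥0)
    {G : Set Ω} (hG : MeasurableSet[𝓕 0] G) :
    ∫⁻ ω in G, ∫⁻ p in univ ×ˢ Ioc 0 t, H (ω, p) ∂(N k ω) ∂P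
      = ∫⁻ ω in G, ∫⁻ s in Ioc 0 t, ∫⁻ z, H (ω, (z, s)) ∂leb ∂leb ∂P := by
  have hHm : Measurable H := hH.mono (markedPredictable_le 𝓕) le_rfl
  have hG' : MeasurableSet[markedPredictable 𝓕] {q : Ω × (ℝ≥0 × ℝ≥0) | q.1 ∈ G} := by
    convert! measurableSet_markedPredictable (Or.inr ⟨rfl, rfl⟩) hG MeasurableSet.univ using 1
    ext ⟨ω, z, v⟩
    simp
  have key := (h.lintegral_lintegral_eq k (hH.indicator hG') t).2
  have hind : ∀ (ω : Ω) (p : ℝ≥0 × ℝ≥0), {q : Ω × (ℝ≥0 × ℝ≥0) | q.1 ∈ G}.indicator H (ω, p)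
      = G.indicator (fun _ => 1) ω * H (ω, p) := fun ω p => by
    by_cases hω : ω ∈ G <;> simp [hω]
  have hHω : ∀ ω, Measurable fun p => H (ω, p) := fun ω => hHm.comp measurable_prodMk_left
  have hpull : ∀ μ : Ω → Measure (ℝ≥0 × ℝ≥0), ∫⁻ ω, ∫⁻ p in univ ×ˢ Ioc 0 t,
      {q : Ω × (ℝ≥0 × ℝ≥0) | q.1 ∈ G}.indicator H (ω, p) ∂(μ ω) ∂P
      = ∫⁻ ω in G, ∫⁻ p in univ ×ˢ Ioc 0 t, H (ω, p) ∂(μ ω) ∂P := fun μ => by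
    rw [← lintegral_indicator (𝓕.le 0 _ hG)]
    refine lintegral_congr fun ω => ?_
    simp only [hind]
    rw [lintegral_const_mul _ (hHω ω)]
    by_cases hω : ω ∈ G <;> simp [hω]
  rw [hpull, hpull] at key
  rw [key]
  refine lintegral_congr fun ω => ?_
  rw [← Measure.prod_restrict, Measure.restrict_univ,
    lintegral_prod_symm _ (hHω ω).aemeasurable]

end Compensation

/-! ### Vectors and running suprema -/

lemma vec_sub_norm {M : ℕ} (x y : Fin M → ℝ≥0) : ‖vec x - vec y‖ = dist x y := by
  rw [← dist_eq_norm]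
  refine le_antisymm ((dist_pi_le_iff dist_nonneg).2 fun m => ?_)
    ((dist_pi_le_iff dist_nonneg).2 fun m => ?_)
  · exact dist_le_pi_dist x y m
  · exact dist_le_pi_dist (vec x) (vec y) m

lemma coe_le_norm_vec {M : ℕ} (x : Fin M → ℝ≥0) (m : Fin M) : (x m : ℝ) ≤ ‖vec x‖ := by
  simpa [vec] using norm_le_pi_norm (vec x) m

lemma abs_sub_le_norm {M : ℕ} (x y : Fin M → ℝ≥0) (m : Fin M) :
    |(x m : ℝ) - y m| ≤ ‖vec x - vec y‖ := by
  simpa [vec] using norm_le_pi_norm (vec x - vec y) m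

lemma continuous_vec {M : ℕ} : Continuous (vec (M := M)) := by
  unfold vec
  fun_prop

lemma supNorm_nonneg {M : ℕ} (z : ℝ≥0 → Fin M → ℝ) (t : ℝ≥0) : 0 ≤ supNorm z t :=
  Real.iSup_nonneg fun _ => norm_nonneg _

/-- The bound `C` ensures that the supremum is a true one: an unbounded real supremum has the
default value `0`. -/
lemma le_supNorm {M : ℕ} {z : ℝ≥0 → Fin M → ℝ} {C : ℝ≥0 → ℝ} (hC : Monotone C)
    (hz : ∀ s, ‖z s‖ ≤ C s) {s t : ℝ≥0} (h : s ≤ t) : ‖z s‖ ≤ supNorm z t :=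
  le_ciSup (f := fun v : Iic t => ‖z v‖)
    ⟨C t, by rintro _ ⟨v, rfl⟩; exact (hz v).trans (hC v.2)⟩ ⟨s, h⟩

lemma supNorm_le {M : ℕ} {z : ℝ≥0 → Fin M → ℝ} {t : ℝ≥0} {C : ℝ} (hz : ∀ s ≤ t, ‖z s‖ ≤ C) :
    supNorm z t ≤ C :=
  have : Nonempty (Iic t) := ⟨⟨t, self_mem_Iic⟩⟩
  ciSup_le fun s => hz s s.2

lemma bddAbove_of_continuous {M : ℕ} {z : ℝ≥0 → Fin M → ℝ} (hz : Continuous z) (t : ℝ≥0) :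
    BddAbove (range fun s : Iic t => ‖z s‖) := by
  have hc : IsCompact (Iic t) := by
    rw [← Icc_bot]
    exact isCompact_Icc
  have := hc.bddAbove_image (f := fun s => ‖z s‖) hz.norm.continuousOn
  rwa [image_eq_range] at this

lemma le_supNorm_of_continuous {M : ℕ} {z : ℝ≥0 → Fin M → ℝ} (hz : Continuous z) {s t : ℝ≥0}
    (h : s ≤ t) : ‖z s‖ ≤ supNorm z t :=
  le_ciSup (bddAbove_of_continuous hz t) (⟨s, h⟩ : Iic t)

lemma monotone_supNorm {M : ℕ} {z : ℝ≥0 → Fin M → ℝ} (hz : Continuous z) :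
    Monotone (supNorm z) := fun _ _ h =>
  supNorm_le fun _ hv => le_supNorm_of_continuous hz (hv.trans h)

/-! ### Left limits -/

lemma IsCadlag.leftLim_le {K : ℕ} {x : ℝ≥0 → Fin K → ℝ≥0} (hx : IsCadlag x) {k : Fin K} {s : ℝ≥0}
    {C : ℝ} (h : ∀ v ≤ s, (x v k : ℝ) ≤ C) : ((Function.leftLim (fun v => x v k) s : ℝ≥0) : ℝ) ≤ C := by
  rcases eq_or_ne s 0 with rfl | hs
  · rw [leftLim_eq_of_isBot fun x => zero_le]
    exact h 0 le_rfl
  · have := nhdsLT_neBot (pos_iff_ne_zero.2 hs)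
    refine le_of_tendsto (NNReal.tendsto_coe.2 (hx.tendsto_leftLim k s)) ?_
    filter_upwards [self_mem_nhdsWithin] with v hv using h v (le_of_lt hv)

lemma IsCadlag.abs_leftLim_sub_le {K : ℕ} {x x' : ℝ≥0 → Fin K → ℝ≥0} (hx : IsCadlag x)
    (hx' : IsCadlag x') {k : Fin K} {s : ℝ≥0} {C : ℝ} (h : ∀ v ≤ s, |(x v k : ℝ) - x' v k| ≤ C) :
    |((Function.leftLim (fun v => x v k) s : ℝ≥0) : ℝ)
      - (Function.leftLim (fun v => x' v k) s : ℝ≥0)| ≤ C := by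
  rcases eq_or_ne s 0 with rfl | hs
  · rw [leftLim_eq_of_isBot fun x => zero_le, leftLim_eq_of_isBot fun x => zero_le]
    exact h 0 le_rfl
  · have := nhdsLT_neBot (pos_iff_ne_zero.2 hs)
    refine le_of_tendsto ((NNReal.tendsto_coe.2 (hx.tendsto_leftLim k s)).sub
      (NNReal.tendsto_coe.2 (hx'.tendsto_leftLim k s))).abs ?_
    filter_upwards [self_mem_nhdsWithin] with v hv using h v (le_of_lt hv)

/-- Needed because the jump integrand of `IsSolution` takes the left limit of the real-valued path,
while the rates take that of the `ℝ≥0`-valued one. -/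
lemma IsCadlag.coe_leftLim {K : ℕ} {x : ℝ≥0 → Fin K → ℝ≥0} (hx : IsCadlag x) (k : Fin K)
    (s : ℝ≥0) : Function.leftLim (fun v => (x v k : ℝ)) s
      = ((Function.leftLim (fun v => x v k) s : ℝ≥0) : ℝ) := by
  rcases eq_or_ne s 0 with rfl | hs
  · rw [leftLim_eq_of_isBot fun x => zero_le, leftLim_eq_of_isBot fun x => zero_le]
  · have := nhdsLT_neBot (pos_iff_ne_zero.2 hs)
    exact leftLim_eq_of_tendsto (NNReal.tendsto_coe.2 (hx.tendsto_leftLim k s))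

/-! ### The size of the jumps -/

/-- The integrand `ℓ(s) 1_{z ≤ β(s)}` of the jump part, at the point `(z, s)`. -/
noncomputable def jump (ℓ β : ℝ≥0 → ℝ≥0) : ℝ≥0 × ℝ≥0 → ℝ :=
  {q : ℝ≥0 × ℝ≥0 | q.1 ≤ β q.2}.indicator fun q => (ℓ q.2 : ℝ)

lemma jump_mk (ℓ β : ℝ≥0 → ℝ≥0) (z s : ℝ≥0) :
    jump ℓ β (z, s) = if z ≤ β s then (ℓ s : ℝ) else 0 := by
  simp [jump, indicator_apply]

lemma jump_nonneg (ℓ β : ℝ≥0 → ℝ≥0) (p : ℝ≥0 × ℝ≥0) : 0 ≤ jump ℓ β p :=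
  indicator_nonneg (fun q _ => (ℓ q.2).2) p

lemma measurable_jump {ℓ β : ℝ≥0 → ℝ≥0} (hℓ : Measurable ℓ) (hβ : Measurable β) :
    Measurable (jump ℓ β) :=
  Measurable.indicator (by fun_prop) (measurableSet_le measurable_fst (hβ.comp measurable_snd))

/-- The integrand is bounded, and vanishes for marks above the largest rate, hence outside a box of
finite mass. -/
lemma integrableOn_jump {μ : Measure (ℝ≥0 × ℝ≥0)}
    (hμ : ∀ n m : ℕ, μ (Iic (n : ℝ≥0) ×ˢ Ioc 0 (m : ℝ≥0)) ≠ ∞) {ℓ β : ℝ≥0 → ℝ≥0}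
    (hℓ : Measurable ℓ) (hβ : Measurable β) {t : ℝ≥0} {C Z : ℝ} (hC : ∀ s ≤ t, (ℓ s : ℝ) ≤ C)
    (hZ : ∀ s ≤ t, (β s : ℝ) ≤ Z) : IntegrableOn (jump ℓ β) (univ ×ˢ Ioc 0 t) μ := by
  obtain ⟨n, hn⟩ := exists_nat_ge Z
  obtain ⟨m, hm⟩ := exists_nat_ge t
  have h1 : IntegrableOn (jump ℓ β) (Iic (n : ℝ≥0) ×ˢ Ioc 0 t) μ := by
    refine Measure.integrableOn_of_bounded (M := C) ?_
      (measurable_jump hℓ hβ).aestronglyMeasurable ?_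
    · exact measure_ne_top_of_subset (prod_mono le_rfl (Ioc_subset_Ioc_right hm)) (hμ n m)
    · filter_upwards [ae_restrict_mem (measurableSet_Iic.prod measurableSet_Ioc)] with p hp
      have h2 := hC p.2 hp.2.2
      rw [Real.norm_of_nonneg (jump_nonneg _ _ _), show p = (p.1, p.2) from rfl, jump_mk]
      split_ifs
      · exact h2
      · exact (ℓ p.2).2.trans h2
  refine h1.of_forall_sdiff_eq_zero (MeasurableSet.univ.prod measurableSet_Ioc) ?_
  rintro ⟨z, s⟩ ⟨⟨-, hs⟩, hz⟩
  rw [jump_mk, if_neg]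
  intro hzβ
  refine hz ⟨?_, hs⟩
  have h3 : (z : ℝ) ≤ n := (NNReal.coe_le_coe.2 hzβ).trans ((hZ s hs.2).trans hn)
  exact_mod_cast h3

/-- For marks below `β` the integrands differ by at most `|ℓ - ℓ'|`, plus `ℓ'` if the mark exceeds
`β'`; between the two rates, the excess is `ℓ'`. This splitting involves the rate of the first
solution only, so `u'` does not enter the growth factor. -/
lemma lintegral_jump_sub_le (ℓ ℓ' β β' : ℝ≥0 → ℝ≥0) (s : ℝ≥0) :
    ∫⁻ z, ENNReal.ofReal |jump ℓ β (z, s) - jump ℓ' β' (z, s)| ∂leb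
      ≤ ENNReal.ofReal (|(ℓ s : ℝ) - ℓ' s| * β s + ℓ' s * |(β s : ℝ) - β' s|) := by
  have hpt : ∀ z, ENNReal.ofReal |jump ℓ β (z, s) - jump ℓ' β' (z, s)| ≤
      (Iic (β s)).indicator (fun _ => ENNReal.ofReal |(ℓ s : ℝ) - ℓ' s|) z
      + ((Ioc (β s) (β' s)).indicator (fun _ => (ℓ' s : ℝ≥0∞)) z
        + (Ioc (β' s) (β s)).indicator (fun _ => (ℓ' s : ℝ≥0∞)) z) := by
    intro z
    simp only [jump_mk, indicator_apply, mem_Iic, mem_Ioc]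
    by_cases h1 : z ≤ β s <;> by_cases h2 : z ≤ β' s
    · simp [h1, h2, not_lt.2 h1, not_lt.2 h2]
    · simp only [h1, h2, not_lt.2 h1, not_le.1 h2, if_true, if_false, sub_zero, and_true,
        and_false, zero_add]
      rw [← ENNReal.ofReal_coe_nnreal, ← ENNReal.ofReal_add (abs_nonneg _) (ℓ' s).coe_nonneg]
      refine ENNReal.ofReal_le_ofReal ?_
      calc |(ℓ s : ℝ)| = |((ℓ s : ℝ) - ℓ' s) + ℓ' s| := by ring_nf
        _ ≤ |(ℓ s : ℝ) - ℓ' s| + |(ℓ' s : ℝ)| := abs_add_le _ _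
        _ = _ := by rw [abs_of_nonneg (ℓ' s).coe_nonneg]
    · simp only [h1, h2, not_le.1 h1, not_lt.2 h2, if_true, if_false, zero_sub, and_true,
        and_false, zero_add, add_zero, abs_neg]
      rw [abs_of_nonneg (ℓ' s).coe_nonneg, ENNReal.ofReal_coe_nnreal]
    · simp [h1, h2]
  have habs : ((β' s - β s : ℝ≥0) : ℝ) + (β s - β' s : ℝ≥0) = |(β s : ℝ) - β' s| := by
    rcases le_total (β s) (β' s) with h | h
    · have h' : (β s : ℝ) ≤ β' s := h
      rw [tsub_eq_zero_of_le h, NNReal.coe_sub h, abs_of_nonpos (by linarith)]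
      simp
    · have h' : (β' s : ℝ) ≤ β s := h
      rw [tsub_eq_zero_of_le h, NNReal.coe_sub h, abs_of_nonneg (by linarith)]
      simp
  refine (lintegral_mono hpt).trans (le_of_eq ?_)
  rw [lintegral_add_left (measurable_const.indicator measurableSet_Iic),
    lintegral_add_left (measurable_const.indicator measurableSet_Ioc),
    lintegral_indicator_const measurableSet_Iic, lintegral_indicator_const measurableSet_Ioc,
    lintegral_indicator_const measurableSet_Ioc, leb_Iic, leb_Ioc, leb_Ioc, ← habs,
    ENNReal.ofReal_add (by positivity) (by positivity), ENNReal.ofReal_mul (abs_nonneg _),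
    ENNReal.ofReal_coe_nnreal, ← mul_add, ← NNReal.coe_add, ← NNReal.coe_mul,
    ENNReal.ofReal_coe_nnreal]
  push_cast
  ring

/-! ### Lipschitz coefficients and the growth rate of the distance -/

section Rate

variable {J : ℕ} {a b : ℝ≥0 × (Fin J → ℝ≥0) → ℝ≥0} {La Lb : ℝ≥0}

lemma abs_sub_le_of_lipschitz {L : ℝ≥0} (hf : LipschitzWith L a) (x x' : ℝ≥0)
    (w w' : Fin J → ℝ≥0) :
    |(a (x, w) : ℝ) - a (x', w')| ≤ L * (|(x : ℝ) - x'| + ‖vec w - vec w'‖) := by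
  have h := hf.dist_le_mul (x, w) (x', w')
  rw [NNReal.dist_eq, Prod.dist_eq, NNReal.dist_eq, ← vec_sub_norm] at h
  refine h.trans ?_
  gcongr
  exact max_le_add_of_nonneg (abs_nonneg _) (norm_nonneg _)

lemma le_of_lipschitz {L : ℝ≥0} (hf : LipschitzWith L b) (x : ℝ≥0) (w : Fin J → ℝ≥0) :
    (b (x, w) : ℝ) ≤ b (0, 0) + L * (x + ‖vec w‖) := by
  have h := abs_sub_le_of_lipschitz hf x 0 w 0
  have h0 : vec (0 : Fin J → ℝ≥0) = 0 := by ext; simp [vec]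
  rw [h0, sub_zero, NNReal.coe_zero, sub_zero, abs_of_nonneg x.coe_nonneg] at h
  linarith [le_abs_self ((b (x, w) : ℝ) - b (0, 0))]

/-- The rate at which the distance of two solutions grows. -/
lemma rate_le (ha : LipschitzWith La a) (hb : LipschitzWith Lb b) {ℓ ℓ' : ℝ≥0 → ℝ≥0}
    {u u' : ℝ≥0 → Fin J → ℝ≥0} {s : ℝ≥0} {B n U δ : ℝ} (hB : 0 ≤ B) (hn : 0 ≤ n)
    (hℓ : (ℓ s : ℝ) ≤ n + B * s) (hℓ' : (ℓ' s : ℝ) ≤ n + B * s) (hU : ‖vec (u s)‖ ≤ U)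
    (hδ : ‖vec (u s) - vec (u' s)‖ ≤ δ) :
    ENNReal.ofReal |(a (ℓ s, u s) : ℝ) - a (ℓ' s, u' s)|
      + ∫⁻ z, ENNReal.ofReal |jump ℓ (fun s => b (ℓ s, u s)) (z, s)
          - jump ℓ' (fun s => b (ℓ' s, u' s)) (z, s)| ∂leb
      ≤ ENNReal.ofReal ((La + b (0, 0) + 2 * Lb * (1 + B)) * (1 + s + U + n)
          * (|(ℓ s : ℝ) - ℓ' s| + δ)) := by
  refine (add_le_add le_rfl (lintegral_jump_sub_le _ _ _ _ s)).trans ?_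
  rw [← ENNReal.ofReal_add (abs_nonneg _) (by positivity)]
  refine ENNReal.ofReal_le_ofReal ?_
  have hU0 := (norm_nonneg _).trans hU
  have hδ0 := (norm_nonneg _).trans hδ
  set d : ℝ := |(ℓ s : ℝ) - ℓ' s| with hd
  have hd0 : 0 ≤ d := abs_nonneg _
  set y : ℝ := 1 + s + U + n with hy
  have hs0 : (0 : ℝ) ≤ s := s.2
  have hBy : n + B * s + U ≤ (1 + B) * y := by
    rw [hy]; nlinarith [mul_nonneg hB hn, mul_nonneg hB hU0, mul_nonneg hB hs0]
  have hy1 : 1 ≤ y := by rw [hy]; linarith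
  have h1 : |(a (ℓ s, u s) : ℝ) - a (ℓ' s, u' s)| ≤ La * (d + δ) :=
    (abs_sub_le_of_lipschitz ha _ _ _ _).trans (by gcongr)
  have h2 : (b (ℓ s, u s) : ℝ) ≤ b (0, 0) + Lb * ((1 + B) * y) :=
    (le_of_lipschitz hb _ _).trans (by gcongr; linarith)
  have h3 : |(b (ℓ s, u s) : ℝ) - b (ℓ' s, u' s)| ≤ Lb * (d + δ) :=
    (abs_sub_le_of_lipschitz hb _ _ _ _).trans (by gcongr)
  have h4 : (ℓ' s : ℝ) ≤ (1 + B) * y := by linarith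
  have hLa : (0 : ℝ) ≤ La := La.2
  have hLb : (0 : ℝ) ≤ Lb := Lb.2
  have hb0 : (0 : ℝ) ≤ b (0, 0) := (b (0, 0)).2
  calc |(a (ℓ s, u s) : ℝ) - a (ℓ' s, u' s)|
        + (d * b (ℓ s, u s) + ℓ' s * |(b (ℓ s, u s) : ℝ) - b (ℓ' s, u' s)|)
      ≤ La * (d + δ) + ((d + δ) * (b (0, 0) + Lb * ((1 + B) * y))
          + (1 + B) * y * (Lb * (d + δ))) := by
        gcongr
        linarith
    _ = (La * 1 + b (0, 0) * 1 + 2 * Lb * (1 + B) * y) * (d + δ) := by ring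
    -- Since `1 ≤ y`, the constant terms are absorbed in the factor `y`.
    _ ≤ (La * y + b (0, 0) * y + 2 * Lb * (1 + B) * y) * (d + δ) := by gcongr
    _ = _ := by ring

end Rate

/-! ### Solutions -/

/-- The path of left limits `s ↦ X_k(s-)`. -/
noncomputable def leftPath {Ω : Type*} {K : ℕ} (X : ℝ≥0 → Ω → Fin K → ℝ≥0) (ω : Ω) (k : Fin K) :
    ℝ≥0 → ℝ≥0 := Function.leftLim fun v => X v ω k

/-- The path of jump rates `s ↦ b_k(X_k(s-), u(s))`, or of drifts when applied to `a_k`. -/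
noncomputable def ratePath {Ω : Type*} {J K : ℕ} (b : Fin K → ℝ≥0 × (Fin J → ℝ≥0) → ℝ≥0)
    (u : ℝ≥0 → Fin J → ℝ≥0) (X : ℝ≥0 → Ω → Fin K → ℝ≥0) (ω : Ω) (k : Fin K) (s : ℝ≥0) : ℝ≥0 :=
  b k (leftPath X ω k s, u s)

lemma norm_vec_sub_le {Ω : Type*} {K : ℕ} {X₀ X₀' : Ω → Fin K → ℝ≥0}
    {X X' : ℝ≥0 → Ω → Fin K → ℝ≥0} {B : ℝ≥0} {ω : Ω}
    (hω : ∀ (t : ℝ≥0) (k : Fin K), (X t ω k : ℝ) ≤ ‖vec (X₀ ω)‖ + B * t)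
    (hω' : ∀ (t : ℝ≥0) (k : Fin K), (X' t ω k : ℝ) ≤ ‖vec (X₀' ω)‖ + B * t) (s : ℝ≥0) :
    ‖vec (X s ω) - vec (X' s ω)‖ ≤ ‖vec (X₀ ω)‖ + ‖vec (X₀' ω)‖ + B * s := by
  refine (pi_norm_le_iff_of_nonneg (by positivity)).2 fun k => ?_
  have h1 := hω s k
  have h2 := hω' s k
  have h3 : (0 : ℝ) ≤ X s ω k := NNReal.coe_nonneg _
  have h4 : (0 : ℝ) ≤ X' s ω k := NNReal.coe_nonneg _
  have h5 := norm_nonneg (vec (X₀ ω))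
  have h6 := norm_nonneg (vec (X₀' ω))
  simp only [Pi.sub_apply, vec, Real.norm_eq_abs]
  rw [abs_le]
  constructor <;> linarith

section Solution

variable {Ω : Type*} [mΩ : MeasurableSpace Ω] {J K : ℕ}
  {a b : Fin K → ℝ≥0 × (Fin J → ℝ≥0) → ℝ≥0} {r : Fin K → ℝ}
  {N : Fin K → Ω → Measure (ℝ≥0 × ℝ≥0)} {𝓕 : Filtration ℝ≥0 mΩ} {P : Measure Ω}
  {u u' : ℝ≥0 → Fin J → ℝ≥0} {X₀ X₀' : Ω → Fin K → ℝ≥0} {X X' : ℝ≥0 → Ω → Fin K → ℝ≥0}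
  {La Lb : Fin K → ℝ≥0} {B : ℝ≥0}

lemma IsSolution.integral_equation (hX : IsSolution a b r N 𝓕 P u X₀ X) :
    ∀ᵐ ω ∂P, ∀ (t : ℝ≥0) (k : Fin K), (X t ω k : ℝ) = X₀ ω k
      + ∫ s in Ioc 0 t, (ratePath a u X ω k s : ℝ) ∂leb
      - (1 - r k) * ∫ p in univ ×ˢ Ioc 0 t,
          jump (leftPath X ω k) (ratePath b u X ω k) p ∂(N k ω) := by
  filter_upwards [hX.equation] with ω hω t k
  rw [hω t k]
  congr 3
  funext p
  simp only [jump, indicator_apply]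
  congr 1
  exact (hX.cadlag ω).coe_leftLim k p.2

lemma IsSolution.measurable_leftPath (hX : IsSolution a b r N 𝓕 P u X₀ X) (k : Fin K) :
    Measurable fun p : Ω × ℝ≥0 => leftPath X p.1 k p.2 :=
  ((measurable_leftLim hX.adapted hX.cadlag k).mono (markedPredictable_le 𝓕) le_rfl).comp
    (measurable_fst.prodMk (measurable_const.prodMk measurable_snd) :
      Measurable fun p : Ω × ℝ≥0 => (p.1, ((0 : ℝ≥0), p.2)))

lemma IsSolution.measurable_ratePath (hX : IsSolution a b r N 𝓕 P u X₀ X)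
    {f : Fin K → ℝ≥0 × (Fin J → ℝ≥0) → ℝ≥0} {w : ℝ≥0 → Fin J → ℝ≥0} {k : Fin K}
    (hf : Continuous (f k)) (hw : Continuous w) :
    Measurable fun p : Ω × ℝ≥0 => ratePath f w X p.1 k p.2 :=
  hf.measurable.comp ((hX.measurable_leftPath k).prodMk (hw.measurable.comp measurable_snd))

/-- Solutions grow at most linearly. -/
lemma IsSolution.le_add_mul (hX : IsSolution a b r N 𝓕 P u X₀ X) (hr : ∀ k, r k ∈ Ioo (0 : ℝ) 1)
    (haB : ∀ k x, a k x ≤ B) :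
    ∀ᵐ ω ∂P, ∀ (t : ℝ≥0) (k : Fin K), (X t ω k : ℝ) ≤ ‖vec (X₀ ω)‖ + B * t := by
  filter_upwards [hX.integral_equation] with ω hω t k
  have h1 : ∫ s in Ioc 0 t, (ratePath a u X ω k s : ℝ) ∂leb ≤ B * t := by
    have h := norm_setIntegral_le_of_norm_le_const (μ := leb) (s := Ioc 0 t) (C := (B : ℝ))
      (f := fun s => (ratePath a u X ω k s : ℝ)) (by rw [leb_Ioc]; exact ENNReal.coe_lt_top)
      (fun s _ => by rw [Real.norm_of_nonneg (NNReal.coe_nonneg _)]; exact haB k _)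
    refine (le_abs_self _).trans (h.trans (le_of_eq ?_))
    rw [Measure.real, leb_Ioc]
    simp
  -- No integrability is needed here, the default value of the integral being `0`. The resulting
  -- bound is what later yields integrability.
  have h2 : 0 ≤ ∫ p in univ ×ˢ Ioc 0 t, jump (leftPath X ω k) (ratePath b u X ω k) p ∂(N k ω) :=
    integral_nonneg fun p => jump_nonneg _ _ p
  have h3 : 0 ≤ 1 - r k := by linarith [(hr k).2]
  rw [hω t k]
  linarith [mul_nonneg h3 h2, coe_le_norm_vec (X₀ ω) k]

lemma leftPath_le (hX : IsSolution a b r N 𝓕 P u X₀ X) {ω : Ω}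
    (hω : ∀ (t : ℝ≥0) (k : Fin K), (X t ω k : ℝ) ≤ ‖vec (X₀ ω)‖ + B * t) (k : Fin K) (s : ℝ≥0) :
    (leftPath X ω k s : ℝ) ≤ ‖vec (X₀ ω)‖ + B * s :=
  (hX.cadlag ω).leftLim_le fun v hv => (hω v k).trans (by gcongr)

lemma integrableOn_ratePath (hX : IsSolution a b r N 𝓕 P u X₀ X) (haB : ∀ k x, a k x ≤ B)
    {k : Fin K} (ha : Continuous (a k)) (hu : Continuous u) (ω : Ω) (t : ℝ≥0) :
    IntegrableOn (fun s => (ratePath a u X ω k s : ℝ)) (Ioc 0 t) leb := by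
  refine Measure.integrableOn_of_bounded (M := (B : ℝ)) ?_ ?_ (ae_of_all _ fun s => ?_)
  · rw [leb_Ioc]; exact ENNReal.coe_ne_top
  · exact (((hX.measurable_ratePath ha hu).comp
      measurable_prodMk_left).coe_nnreal_real).aestronglyMeasurable
  · rw [Real.norm_of_nonneg (NNReal.coe_nonneg _)]
    exact haB k _

lemma integrableOn_jump_leftPath (hX : IsSolution a b r N 𝓕 P u X₀ X) {k : Fin K}
    (hb : LipschitzWith (Lb k) (b k)) (hu : Continuous u) {ω : Ω}
    (hω : ∀ (t : ℝ≥0) (k : Fin K), (X t ω k : ℝ) ≤ ‖vec (X₀ ω)‖ + B * t)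
    (hN : ∀ n m : ℕ, N k ω (Iic (n : ℝ≥0) ×ˢ Ioc 0 (m : ℝ≥0)) ≠ ∞) (t : ℝ≥0) :
    IntegrableOn (jump (leftPath X ω k) (ratePath b u X ω k)) (univ ×ˢ Ioc 0 t) (N k ω) := by
  have hℓ : ∀ s ≤ t, (leftPath X ω k s : ℝ) ≤ ‖vec (X₀ ω)‖ + B * t := fun s hs =>
    (leftPath_le hX hω k s).trans (by gcongr)
  refine integrableOn_jump hN ((hX.measurable_leftPath k).comp measurable_prodMk_left)
    ((hX.measurable_ratePath hb.continuous hu).comp measurable_prodMk_left) hℓ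
    (Z := b k (0, 0) + Lb k * ((‖vec (X₀ ω)‖ + B * t) + supNorm (fun s => vec (u s)) t))
    fun s hs => (le_of_lipschitz hb _ _).trans ?_
  gcongr
  · exact hℓ s hs
  · exact le_supNorm_of_continuous (continuous_vec.comp hu) hs

lemma ofReal_abs_integral_sub_le {α : Type*} [MeasurableSpace α] {μ : Measure α} {f g : α → ℝ}
    (hf : Integrable f μ) (hg : Integrable g μ) :
    ENNReal.ofReal |∫ x, f x ∂μ - ∫ x, g x ∂μ| ≤ ∫⁻ x, ENNReal.ofReal |f x - g x| ∂μ := by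
  rw [← integral_sub hf hg, ← Real.norm_eq_abs]
  refine (ofReal_norm _).trans_le ((enorm_integral_le_lintegral_enorm _).trans
    (le_of_eq (lintegral_congr fun x => ?_)))
  rw [← ofReal_norm, Real.norm_eq_abs]

/-- The pathwise bound on the distance of two solutions. -/
lemma ae_ofReal_supNorm_le (hN : IsDrivingNoise N 𝓕 P) (hr : ∀ k, r k ∈ Ioo (0 : ℝ) 1)
    (haB : ∀ k x, a k x ≤ B) (ha : ∀ k, LipschitzWith (La k) (a k))
    (hb : ∀ k, LipschitzWith (Lb k) (b k)) (hu : Continuous u) (hu' : Continuous u')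
    (hX : IsSolution a b r N 𝓕 P u X₀ X) (hX' : IsSolution a b r N 𝓕 P u' X₀' X') (t : ℝ≥0) :
    ∀ᵐ ω ∂P, ENNReal.ofReal (supNorm (fun s => vec (X s ω) - vec (X' s ω)) t)
      ≤ ENNReal.ofReal ‖vec (X₀ ω) - vec (X₀' ω)‖
        + ∑ k, (∫⁻ s in Ioc 0 t,
            ENNReal.ofReal |(ratePath a u X ω k s : ℝ) - ratePath a u' X' ω k s| ∂leb
          + ∫⁻ p in univ ×ˢ Ioc 0 t, ENNReal.ofReal
            |jump (leftPath X ω k) (ratePath b u X ω k) p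
              - jump (leftPath X' ω k) (ratePath b u' X' ω k) p| ∂(N k ω)) := by
  filter_upwards [hX.integral_equation, hX'.integral_equation, hX.le_add_mul hr haB,
    hX'.le_add_mul hr haB, ae_all_iff.2 hN.ae_ne_top] with ω h1 h2 h3 h4 h5
  set S := ENNReal.ofReal ‖vec (X₀ ω) - vec (X₀' ω)‖
        + ∑ k, (∫⁻ s in Ioc 0 t,
            ENNReal.ofReal |(ratePath a u X ω k s : ℝ) - ratePath a u' X' ω k s| ∂leb
          + ∫⁻ p in univ ×ˢ Ioc 0 t, ENNReal.ofReal
            |jump (leftPath X ω k) (ratePath b u X ω k) p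
              - jump (leftPath X' ω k) (ratePath b u' X' ω k) p| ∂(N k ω)) with hS
  rcases eq_or_ne S ∞ with hS' | hS'
  · rw [hS']; exact le_top
  rw [ENNReal.ofReal_le_iff_le_toReal hS']
  refine supNorm_le fun s hs => (pi_norm_le_iff_of_nonneg ENNReal.toReal_nonneg).2 fun k => ?_
  rw [← ENNReal.ofReal_le_iff_le_toReal hS', Real.norm_eq_abs]
  simp only [Pi.sub_apply, vec]
  set IA := ∫ v in Ioc 0 s, (ratePath a u X ω k v : ℝ) ∂leb with hIA
  set IA' := ∫ v in Ioc 0 s, (ratePath a u' X' ω k v : ℝ) ∂leb with hIA'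
  set IJ := ∫ p in univ ×ˢ Ioc 0 s, jump (leftPath X ω k) (ratePath b u X ω k) p ∂(N k ω) with hIJ
  set IJ' := ∫ p in univ ×ˢ Ioc 0 s,
    jump (leftPath X' ω k) (ratePath b u' X' ω k) p ∂(N k ω) with hIJ'
  have hreal : |(X s ω k : ℝ) - X' s ω k|
      ≤ ‖vec (X₀ ω) - vec (X₀' ω)‖ + (|IA - IA'| + |IJ - IJ'|) := by
    rw [h1 s k, h2 s k, ← hIA, ← hIA', ← hIJ, ← hIJ']
    have e : (X₀ ω k : ℝ) + IA - (1 - r k) * IJ - (X₀' ω k + IA' - (1 - r k) * IJ')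
        = ((X₀ ω k : ℝ) - X₀' ω k) + ((IA - IA') + (-((1 - r k) * (IJ - IJ')))) := by ring
    rw [e]
    refine (abs_add_le _ _).trans (add_le_add (abs_sub_le_norm _ _ k) ((abs_add_le _ _).trans
      (add_le_add le_rfl ?_)))
    rw [abs_neg, abs_mul, abs_of_nonneg (by linarith [(hr k).2])]
    exact mul_le_of_le_one_left (abs_nonneg _) (by linarith [(hr k).1])
  refine (ENNReal.ofReal_le_ofReal hreal).trans ?_
  rw [ENNReal.ofReal_add (norm_nonneg _) (by positivity),
    ENNReal.ofReal_add (abs_nonneg _) (abs_nonneg _), hS]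
  refine add_le_add le_rfl (le_trans ?_ (Finset.single_le_sum (fun _ _ => zero_le)
    (Finset.mem_univ k)))
  -- With absolute values inside, the integrals over `(0, s]` are at most those over `(0, t]`: the
  -- bound is uniform in `s` and passes to the supremum.
  refine add_le_add ?_ ?_
  · refine (ofReal_abs_integral_sub_le (integrableOn_ratePath hX haB (ha k).continuous hu ω s)
      (integrableOn_ratePath hX' haB (ha k).continuous hu' ω s)).trans ?_
    exact lintegral_mono_set (Ioc_subset_Ioc_right hs)
  · refine (ofReal_abs_integral_sub_le (integrableOn_jump_leftPath hX (hb k) hu h3 (h5 k) s)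
      (integrableOn_jump_leftPath hX' (hb k) hu' h4 (h5 k) s)).trans ?_
    exact lintegral_mono_set (prod_mono le_rfl (Ioc_subset_Ioc_right hs))

/-- The integrand is a Borel function of the mark, the time and the two left limits, all of which
are predictable. -/
lemma measurable_jump_sub (hX : IsSolution a b r N 𝓕 P u X₀ X)
    (hX' : IsSolution a b r N 𝓕 P u' X₀' X') {k : Fin K} (hb : Continuous (b k))
    (hu : Continuous u) (hu' : Continuous u') :
    Measurable[markedPredictable 𝓕] fun q : Ω × (ℝ≥0 × ℝ≥0) => ENNReal.ofReal
      |jump (leftPath X q.1 k) (ratePath b u X q.1 k) q.2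
        - jump (leftPath X' q.1 k) (ratePath b u' X' q.1 k) q.2| := by
  have hh : ∀ {w : ℝ≥0 → Fin J → ℝ≥0}, Continuous w →
      Measurable fun v : ℝ≥0 × ℝ≥0 × ℝ≥0 => if v.1 ≤ b k (v.2.2, w v.2.1) then (v.2.2 : ℝ) else 0 :=
    fun hw => Measurable.ite (measurableSet_le measurable_fst (hb.comp (by fun_prop)).measurable)
      (by fun_prop) measurable_const
  have h1 := (hh hu).comp (measurable_mark.prodMk (measurable_time.prodMk
    (measurable_leftLim hX.adapted hX.cadlag k)))
  have h2 := (hh hu').comp (measurable_mark.prodMk (measurable_time.prodMk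
    (measurable_leftLim hX'.adapted hX'.cadlag k)))
  have h3 : Measurable fun v : ℝ × ℝ => ENNReal.ofReal |v.1 - v.2| := by fun_prop
  convert! h3.comp (h1.prodMk h2) using 1

end Solution

/-! ### The growth factor and the cost of changing the input -/

section Growth

variable {J K : ℕ} {u u' : ℝ≥0 → Fin J → ℝ≥0}

lemma growth_eq_mul (A : ℝ) (u : ℝ≥0 → Fin J → ℝ≥0) (x x' : Fin K → ℝ≥0) (t : ℝ≥0) :
    growth A u x x' t = A * growth 1 u x x' t := by
  simp [growth]

lemma one_le_growth (u : ℝ≥0 → Fin J → ℝ≥0) (x x' : Fin K → ℝ≥0) (t : ℝ≥0) :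
    1 ≤ growth 1 u x x' t := by
  have h1 : (0 : ℝ) ≤ t := t.coe_nonneg
  have h2 := supNorm_nonneg (fun s => vec (u s)) t
  have h3 := norm_nonneg (vec x)
  have h4 := norm_nonneg (vec x')
  rw [growth]
  linarith

lemma monotone_growth (hu : Continuous u) (x x' : Fin K → ℝ≥0) :
    Monotone (growth 1 u x x') := fun s t h => by
  have h1 : (s : ℝ) ≤ t := h
  have h2 := monotone_supNorm (continuous_vec.comp hu) h
  simp only [growth, one_mul]
  change supNorm (fun s => vec (u s)) s ≤ supNorm (fun s => vec (u s)) t at h2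
  linarith

lemma measurable_growth (hu : Continuous u) :
    Measurable fun p : ((Fin K → ℝ≥0) × (Fin K → ℝ≥0)) × ℝ≥0 => growth 1 u p.1.1 p.1.2 p.2 := by
  -- Running suprema are monotone in time, hence measurable.
  have h1 : Measurable (supNorm fun s => vec (u s)) :=
    (monotone_supNorm (continuous_vec.comp hu)).measurable
  have h2 : Measurable (vec (M := K)) := continuous_vec.measurable
  unfold growth
  fun_prop

/-- The contribution `∫₀ᵗ (1 + s + ‖u‖_s + ‖x‖ + ‖x'‖) ‖u - u'‖_s ds` of the difference of the
inputs. -/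
noncomputable def inputCost (u u' : ℝ≥0 → Fin J → ℝ≥0) (t : ℝ≥0)
    (q : (Fin K → ℝ≥0) × (Fin K → ℝ≥0)) : ℝ≥0∞ :=
  ∫⁻ s in Ioc 0 t, ENNReal.ofReal
    (growth 1 u q.1 q.2 s * supNorm (fun v => vec (u v) - vec (u' v)) s) ∂leb

lemma continuous_vec_sub (hu : Continuous u) (hu' : Continuous u') :
    Continuous fun v => vec (u v) - vec (u' v) :=
  (continuous_vec.comp hu).sub (continuous_vec.comp hu')

lemma measurable_growth_mul (hu : Continuous u) (hu' : Continuous u') :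
    Measurable fun p : ((Fin K → ℝ≥0) × (Fin K → ℝ≥0)) × ℝ≥0 =>
      growth 1 u p.1.1 p.1.2 p.2 * supNorm (fun v => vec (u v) - vec (u' v)) p.2 :=
  (measurable_growth hu).mul
    ((monotone_supNorm (continuous_vec_sub hu hu')).measurable.comp measurable_snd)

lemma measurable_inputCost (hu : Continuous u) (hu' : Continuous u') (t : ℝ≥0) :
    Measurable (inputCost (K := K) u u' t) :=
  (measurable_growth_mul hu hu').ennreal_ofReal.lintegral_prod_right'

lemma ofReal_mul_inputCost_le (hu : Continuous u) (hu' : Continuous u') (t : ℝ≥0) {c A : ℝ}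
    (hc : 0 ≤ c) (hA : c ≤ A) (x x' : Fin K → ℝ≥0) :
    ENNReal.ofReal c * inputCost u u' t (x, x') ≤ ENNReal.ofReal (∫ s in Ioc 0 t,
      growth A u x x' s * supNorm (fun v => vec (u v) - vec (u' v)) s ∂leb) := by
  have hδ : ∀ s, 0 ≤ supNorm (fun v => vec (u v) - vec (u' v)) s := supNorm_nonneg _
  have hg : ∀ s, 0 ≤ growth 1 u x x' s := fun s => zero_le_one.trans (one_le_growth u x x' s)
  have hint : IntegrableOn (fun s => growth 1 u x x' s *
      supNorm (fun v => vec (u v) - vec (u' v)) s) (Ioc 0 t) leb := by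
    refine Measure.integrableOn_of_bounded
      (M := growth 1 u x x' t * supNorm (fun v => vec (u v) - vec (u' v)) t) ?_ ?_ ?_
    · rw [leb_Ioc]; exact ENNReal.coe_ne_top
    · exact ((measurable_growth_mul hu hu').comp
        (measurable_prodMk_left (x := (x, x')))).aestronglyMeasurable
    · filter_upwards [ae_restrict_mem measurableSet_Ioc] with s hs
      rw [Real.norm_of_nonneg (mul_nonneg (hg s) (hδ s))]
      exact mul_le_mul (monotone_growth hu x x' hs.2)
        (monotone_supNorm (continuous_vec_sub hu hu') hs.2) (hδ s) (hg t)
  have heq : ∀ s, growth A u x x' s * supNorm (fun v => vec (u v) - vec (u' v)) s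
      = A * (growth 1 u x x' s * supNorm (fun v => vec (u v) - vec (u' v)) s) := fun s => by
    rw [growth_eq_mul]; ring
  simp only [heq]
  rw [integral_const_mul, ENNReal.ofReal_mul (hc.trans hA), ofReal_integral_eq_lintegral_ofReal hint
    (ae_of_all _ fun s => mul_nonneg (hg s) (hδ s))]
  exact mul_le_mul_left (ENNReal.ofReal_le_ofReal hA) _

end Growth

/-! ### Gronwall estimate for the mean distance over an event of `𝓕 0` -/

section Main

variable {Ω : Type*} [mΩ : MeasurableSpace Ω] {J K : ℕ}
  {a b : Fin K → ℝ≥0 × (Fin J → ℝ≥0) → ℝ≥0} {r : Fin K → ℝ}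
  {N : Fin K → Ω → Measure (ℝ≥0 × ℝ≥0)} {𝓕 : Filtration ℝ≥0 mΩ} {P : Measure Ω}
  {u u' : ℝ≥0 → Fin J → ℝ≥0} {X₀ X₀' : Ω → Fin K → ℝ≥0} {X X' : ℝ≥0 → Ω → Fin K → ℝ≥0}
  {La Lb : Fin K → ℝ≥0} {B : ℝ≥0}

/-- The mean over `G` of the distance of two solutions. -/
noncomputable def meanDist (P : Measure Ω) (X X' : ℝ≥0 → Ω → Fin K → ℝ≥0) (G : Set Ω) (s : ℝ≥0) :
    ℝ≥0∞ :=
  ∫⁻ ω in G, ENNReal.ofReal (supNorm (fun s => vec (X s ω) - vec (X' s ω)) s) ∂P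

lemma lintegral_abs_leftPath_sub_le [IsProbabilityMeasure P]
    (hr : ∀ k, r k ∈ Ioo (0 : ℝ) 1) (haB : ∀ k x, a k x ≤ B)
    (hX : IsSolution a b r N 𝓕 P u X₀ X) (hX' : IsSolution a b r N 𝓕 P u' X₀' X')
    (G : Set Ω) (k : Fin K) (s : ℝ≥0) :
    ∫⁻ ω in G, ENNReal.ofReal |(leftPath X ω k s : ℝ) - leftPath X' ω k s| ∂P
      ≤ meanDist P X X' G s := by
  refine lintegral_mono_ae (ae_restrict_of_ae ?_)
  filter_upwards [hX.le_add_mul hr haB, hX'.le_add_mul hr haB] with ω h1 h2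
  refine ENNReal.ofReal_le_ofReal ((hX.cadlag ω).abs_leftLim_sub_le (hX'.cadlag ω) fun v hv => ?_)
  refine (abs_sub_le_norm _ _ k).trans (le_supNorm (z := fun s => vec (X s ω) - vec (X' s ω))
    (C := fun s => ‖vec (X₀ ω)‖ + ‖vec (X₀' ω)‖ + B * s) ?_ (norm_vec_sub_le h1 h2) hv)
  intro s t h
  have : (s : ℝ) ≤ t := h
  simp only
  gcongr

lemma measurable_abs_drift_sub (hX : IsSolution a b r N 𝓕 P u X₀ X)
    (hX' : IsSolution a b r N 𝓕 P u' X₀' X') {k : Fin K} (ha : Continuous (a k))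
    (hu : Continuous u) (hu' : Continuous u') : Measurable fun p : Ω × ℝ≥0 =>
      ENNReal.ofReal |(ratePath a u X p.1 k p.2 : ℝ) - ratePath a u' X' p.1 k p.2| := by
  have h1 := (hX.measurable_ratePath ha hu).coe_nnreal_real
  have h2 := (hX'.measurable_ratePath ha hu').coe_nnreal_real
  have h3 : Measurable fun v : ℝ × ℝ => ENNReal.ofReal |v.1 - v.2| := by fun_prop
  exact h3.comp (h1.prodMk h2)

/-- After compensation, `rate_le` applies at each time, and `m` replaces the random growth factor in
front of the distance so that it leaves the mean. In front of the input difference the factor stays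
random. -/
lemma lintegral_rate_le [IsProbabilityMeasure P] (hN : IsDrivingNoise N 𝓕 P)
    (hr : ∀ k, r k ∈ Ioo (0 : ℝ) 1)
    (haB : ∀ k x, a k x ≤ B) (ha : ∀ k, LipschitzWith (La k) (a k))
    (hb : ∀ k, LipschitzWith (Lb k) (b k)) (hu : Continuous u) (hu' : Continuous u')
    (hX₀ : Measurable X₀) (hX₀' : Measurable X₀')
    (hX : IsSolution a b r N 𝓕 P u X₀ X) (hX' : IsSolution a b r N 𝓕 P u' X₀' X')
    {G : Set Ω} (hG : MeasurableSet[𝓕 0] G) {s t : ℝ≥0} (hst : s ≤ t) {m : ℝ}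
    (hm : ∀ ω ∈ G, growth 1 u (X₀ ω) (X₀' ω) t ≤ m) (k : Fin K) :
    ∫⁻ ω in G, (∫⁻ v in Ioc 0 s,
        ENNReal.ofReal |(ratePath a u X ω k v : ℝ) - ratePath a u' X' ω k v| ∂leb) ∂P
      + ∫⁻ ω in G, (∫⁻ p in univ ×ˢ Ioc 0 s, ENNReal.ofReal
          |jump (leftPath X ω k) (ratePath b u X ω k) p
            - jump (leftPath X' ω k) (ratePath b u' X' ω k) p| ∂(N k ω)) ∂P
      ≤ ENNReal.ofReal (La k + b k (0, 0) + 2 * Lb k * (1 + B))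
        * (∫⁻ ω in G, inputCost u u' t (X₀ ω, X₀' ω) ∂P
          + ENNReal.ofReal m * ∫⁻ v in Ioc 0 s, meanDist P X X' G v ∂leb) := by
  have hA := measurable_abs_drift_sub (k := k) hX hX' (ha k).continuous hu hu'
  have hd : Measurable fun p : Ω × ℝ≥0 =>
      ENNReal.ofReal |(leftPath X p.1 k p.2 : ℝ) - leftPath X' p.1 k p.2| := by
    have h1 := (hX.measurable_leftPath k).coe_nnreal_real
    have h2 := (hX'.measurable_leftPath k).coe_nnreal_real
    have h3 : Measurable fun v : ℝ × ℝ => ENNReal.ofReal |v.1 - v.2| := by fun_prop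
    exact h3.comp (h1.prodMk h2)
  have hW : Measurable fun ω => inputCost u u' t (X₀ ω, X₀' ω) :=
    (measurable_inputCost hu hu' t).comp (hX₀.prodMk hX₀')
  set c : ℝ := La k + b k (0, 0) + 2 * Lb k * (1 + B) with hc
  have hc0 : 0 ≤ c := by positivity
  set δ := supNorm (fun v => vec (u v) - vec (u' v)) with hδ
  rw [hN.setLIntegral_lintegral_eq k (measurable_jump_sub hX hX' (hb k).continuous hu hu') s hG,
    ← lintegral_add_left hA.lintegral_prod_right']
  have hpt : ∀ᵐ ω ∂(P.restrict G), (∫⁻ v in Ioc 0 s,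
        ENNReal.ofReal |(ratePath a u X ω k v : ℝ) - ratePath a u' X' ω k v| ∂leb)
      + (∫⁻ v in Ioc 0 s, ∫⁻ z, ENNReal.ofReal
          |jump (leftPath X ω k) (ratePath b u X ω k) (z, v)
            - jump (leftPath X' ω k) (ratePath b u' X' ω k) (z, v)| ∂leb ∂leb)
      ≤ ENNReal.ofReal c * (inputCost u u' t (X₀ ω, X₀' ω) + ENNReal.ofReal m
        * ∫⁻ v in Ioc 0 s, ENNReal.ofReal |(leftPath X ω k v : ℝ) - leftPath X' ω k v| ∂leb) := by
    filter_upwards [ae_restrict_mem (𝓕.le 0 _ hG), ae_restrict_of_ae (hX.le_add_mul hr haB),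
      ae_restrict_of_ae (hX'.le_add_mul hr haB)] with ω hωG h1 h2
    have hg : ∀ v, 0 ≤ growth 1 u (X₀ ω) (X₀' ω) v := fun v =>
      zero_le_one.trans (one_le_growth u _ _ v)
    have hm0 : 0 ≤ m := (hg t).trans (hm ω hωG)
    have hAω : Measurable fun v =>
        ENNReal.ofReal |(ratePath a u X ω k v : ℝ) - ratePath a u' X' ω k v| :=
      (hA.comp (measurable_prodMk_left (x := ω)) :)
    have hdω : Measurable fun v => ENNReal.ofReal |(leftPath X ω k v : ℝ) - leftPath X' ω k v| :=
      (hd.comp (measurable_prodMk_left (x := ω)) :)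
    rw [← lintegral_add_left hAω]
    have hrate : ∀ v ∈ Ioc 0 s,
        ENNReal.ofReal |(ratePath a u X ω k v : ℝ) - ratePath a u' X' ω k v|
        + ∫⁻ z, ENNReal.ofReal
          |jump (leftPath X ω k) (ratePath b u X ω k) (z, v)
            - jump (leftPath X' ω k) (ratePath b u' X' ω k) (z, v)| ∂leb
        ≤ ENNReal.ofReal c * (ENNReal.ofReal (growth 1 u (X₀ ω) (X₀' ω) v * δ v)
          + ENNReal.ofReal m
            * ENNReal.ofReal |(leftPath X ω k v : ℝ) - leftPath X' ω k v|) := by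
      intro v hv
      have hn := norm_nonneg (vec (X₀ ω))
      have hn' := norm_nonneg (vec (X₀' ω))
      refine (rate_le (ha k) (hb k) (B := B) (n := ‖vec (X₀ ω)‖ + ‖vec (X₀' ω)‖)
        (U := supNorm (fun s => vec (u s)) v) (δ := δ v) B.coe_nonneg (by positivity)
        ((leftPath_le hX h1 k v).trans (by linarith)) ((leftPath_le hX' h2 k v).trans (by linarith))
        (le_supNorm_of_continuous (continuous_vec.comp hu) le_rfl)
        (le_supNorm_of_continuous (continuous_vec_sub hu hu') le_rfl)).trans ?_
      rw [← ENNReal.ofReal_mul hm0, ← ENNReal.ofReal_add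
        (mul_nonneg (hg v) (supNorm_nonneg _ _)) (by positivity), ← ENNReal.ofReal_mul hc0]
      refine ENNReal.ofReal_le_ofReal ?_
      have hgm : growth 1 u (X₀ ω) (X₀' ω) v ≤ m :=
        (monotone_growth hu _ _ (hv.2.trans hst)).trans (hm ω hωG)
      calc _ = c * (growth 1 u (X₀ ω) (X₀' ω) v * δ v + growth 1 u (X₀ ω) (X₀' ω) v
            * |(leftPath X ω k v : ℝ) - leftPath X' ω k v|) := by
            rw [growth]; ring
        _ ≤ _ := by gcongr
    refine (setLIntegral_mono' measurableSet_Ioc hrate).trans ?_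
    rw [lintegral_const_mul' _ _ ENNReal.ofReal_ne_top, lintegral_add_right _
      (hdω.const_mul _),
      lintegral_const_mul' _ _ ENNReal.ofReal_ne_top]
    gcongr
    exact lintegral_mono_set (Ioc_subset_Ioc_right hst)
  refine (lintegral_mono_ae hpt).trans ?_
  -- Tonelli is applied to the left limits, which are jointly measurable; only afterwards are they
  -- bounded by the running supremum.
  rw [lintegral_const_mul' _ _ ENNReal.ofReal_ne_top, lintegral_add_left hW,
    lintegral_const_mul' _ _ ENNReal.ofReal_ne_top, lintegral_lintegral_swap hd.aemeasurable]
  gcongr with v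
  exact lintegral_abs_leftPath_sub_le hr haB hX hX' G k v

/-- The constant of the estimate. -/
noncomputable def rateConst (b : Fin K → ℝ≥0 × (Fin J → ℝ≥0) → ℝ≥0) (La Lb : Fin K → ℝ≥0)
    (B : ℝ≥0) : ℝ :=
  1 + ∑ k, ((La k : ℝ) + b k (0, 0) + 2 * Lb k * (1 + B))

/-- The summand `1` keeps the constant positive even if all coefficients vanish, as `gronwall`
requires. -/
lemma rateConst_pos (b : Fin K → ℝ≥0 × (Fin J → ℝ≥0) → ℝ≥0) (La Lb : Fin K → ℝ≥0) (B : ℝ≥0) :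
    0 < rateConst b La Lb B := by
  unfold rateConst
  positivity

lemma meanDist_le [IsProbabilityMeasure P] (hN : IsDrivingNoise N 𝓕 P)
    (hr : ∀ k, r k ∈ Ioo (0 : ℝ) 1)
    (haB : ∀ k x, a k x ≤ B) (ha : ∀ k, LipschitzWith (La k) (a k))
    (hb : ∀ k, LipschitzWith (Lb k) (b k)) (hu : Continuous u) (hu' : Continuous u')
    (hX₀ : Measurable X₀) (hX₀' : Measurable X₀')
    (hX : IsSolution a b r N 𝓕 P u X₀ X) (hX' : IsSolution a b r N 𝓕 P u' X₀' X')
    {G : Set Ω} (hG : MeasurableSet[𝓕 0] G) {s t : ℝ≥0} (hst : s ≤ t) {m : ℝ}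
    (hm : ∀ ω ∈ G, growth 1 u (X₀ ω) (X₀' ω) t ≤ m) :
    meanDist P X X' G s ≤ ∫⁻ ω in G, (ENNReal.ofReal ‖vec (X₀ ω) - vec (X₀' ω)‖
        + ENNReal.ofReal (rateConst b La Lb B) * inputCost u u' t (X₀ ω, X₀' ω)) ∂P
      + ENNReal.ofReal (rateConst b La Lb B * m) * ∫⁻ v in Ioc 0 s, meanDist P X X' G v ∂leb := by
  have hA : ∀ k, Measurable fun ω => ∫⁻ v in Ioc 0 s,
      ENNReal.ofReal |(ratePath a u X ω k v : ℝ) - ratePath a u' X' ω k v| ∂leb := fun k =>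
    (measurable_abs_drift_sub hX hX' (ha k).continuous hu hu').lintegral_prod_right'
  have hM : ∀ k, AEMeasurable (fun ω => ∫⁻ p in univ ×ˢ Ioc 0 s, ENNReal.ofReal
      |jump (leftPath X ω k) (ratePath b u X ω k) p
        - jump (leftPath X' ω k) (ratePath b u' X' ω k) p| ∂(N k ω)) (P.restrict G) := fun k =>
    (hN.lintegral_lintegral_eq k
      (measurable_jump_sub hX hX' (hb k).continuous hu hu') s).1.restrict
  have hdist : Measurable fun ω => ENNReal.ofReal ‖vec (X₀ ω) - vec (X₀' ω)‖ :=
    ((continuous_vec.measurable.comp hX₀).sub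
      (continuous_vec.measurable.comp hX₀')).norm.ennreal_ofReal
  set E := ∫⁻ ω in G, inputCost u u' t (X₀ ω, X₀' ω) ∂P
    + ENNReal.ofReal m * ∫⁻ v in Ioc 0 s, meanDist P X X' G v ∂leb with hE
  calc meanDist P X X' G s
      ≤ ∫⁻ ω in G, ENNReal.ofReal ‖vec (X₀ ω) - vec (X₀' ω)‖ ∂P
        + ∑ k, ENNReal.ofReal (La k + b k (0, 0) + 2 * Lb k * (1 + B)) * E := by
        refine (lintegral_mono_ae (ae_restrict_of_ae
          (ae_ofReal_supNorm_le hN hr haB ha hb hu hu' hX hX' s))).trans ?_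
        rw [lintegral_add_left hdist, lintegral_finsetSum' _ fun k _ => by
          simpa only [Pi.add_def] using (hA k).aemeasurable.add (hM k)]
        refine add_le_add le_rfl (Finset.sum_le_sum fun k _ => ?_)
        rw [lintegral_add_left (hA k)]
        exact lintegral_rate_le hN hr haB ha hb hu hu' hX₀ hX₀' hX hX' hG hst hm k
    _ = ∫⁻ ω in G, ENNReal.ofReal ‖vec (X₀ ω) - vec (X₀' ω)‖ ∂P
        + ENNReal.ofReal (∑ k, ((La k : ℝ) + b k (0, 0) + 2 * Lb k * (1 + B))) * E := by
        rw [ENNReal.ofReal_sum_of_nonneg fun k _ => by positivity, Finset.sum_mul]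
    _ ≤ ∫⁻ ω in G, ENNReal.ofReal ‖vec (X₀ ω) - vec (X₀' ω)‖ ∂P
        + ENNReal.ofReal (rateConst b La Lb B) * E := by
        gcongr
        rw [rateConst]
        linarith
    _ = _ := by
        rw [lintegral_add_left hdist, lintegral_const_mul' _ _ ENNReal.ofReal_ne_top, hE, mul_add,
          ENNReal.ofReal_mul (rateConst_pos _ _ _ _).le]
        ring

/-- The a priori finite bound that `gronwall` requires; it comes from the linear growth of
solutions. -/
lemma meanDist_le_of_growth_le [IsProbabilityMeasure P]
    (hr : ∀ k, r k ∈ Ioo (0 : ℝ) 1) (haB : ∀ k x, a k x ≤ B)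
    (hX : IsSolution a b r N 𝓕 P u X₀ X) (hX' : IsSolution a b r N 𝓕 P u' X₀' X')
    {G : Set Ω} (hG : MeasurableSet G) {s t : ℝ≥0} (hst : s ≤ t) {m : ℝ}
    (hm : ∀ ω ∈ G, growth 1 u (X₀ ω) (X₀' ω) t ≤ m) :
    meanDist P X X' G s ≤ ENNReal.ofReal ((1 + B) * m) := by
  calc meanDist P X X' G s ≤ ∫⁻ _ in G, ENNReal.ofReal ((1 + B) * m) ∂P := by
        refine lintegral_mono_ae ?_
        filter_upwards [ae_restrict_mem hG, ae_restrict_of_ae (hX.le_add_mul hr haB),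
          ae_restrict_of_ae (hX'.le_add_mul hr haB)] with ω hωG h1 h2
        refine ENNReal.ofReal_le_ofReal (supNorm_le fun v hv => (norm_vec_sub_le h1 h2 v).trans ?_)
        have h3 := hm ω hωG
        rw [growth, one_mul] at h3
        have h4 : (v : ℝ) ≤ t := hv.trans hst
        have h5 := supNorm_nonneg (fun s => vec (u s)) t
        have h6 := norm_nonneg (vec (X₀ ω))
        have h7 := norm_nonneg (vec (X₀' ω))
        have h8 : (v : ℝ) ≤ m := by linarith
        have h9 : (B : ℝ) * v ≤ B * m := by gcongr
        have h10 : (0 : ℝ) ≤ t := t.coe_nonneg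
        linarith
    _ ≤ _ := by
        rw [lintegral_const, Measure.restrict_apply_univ]
        exact mul_le_of_le_one_right zero_le prob_le_one

lemma meanDist_le_lintegral [IsProbabilityMeasure P] (hN : IsDrivingNoise N 𝓕 P)
    (hr : ∀ k, r k ∈ Ioo (0 : ℝ) 1)
    (haB : ∀ k x, a k x ≤ B) (ha : ∀ k, LipschitzWith (La k) (a k))
    (hb : ∀ k, LipschitzWith (Lb k) (b k)) (hu : Continuous u) (hu' : Continuous u')
    (hX₀ : Measurable[𝓕 0] X₀) (hX₀' : Measurable[𝓕 0] X₀')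
    (hX : IsSolution a b r N 𝓕 P u X₀ X) (hX' : IsSolution a b r N 𝓕 P u' X₀' X')
    {G : Set Ω} (hG : MeasurableSet[𝓕 0] G) (t : ℝ≥0) :
    meanDist P X X' G t ≤ ∫⁻ ω in G, (ENNReal.ofReal ‖vec (X₀ ω) - vec (X₀' ω)‖
        + ENNReal.ofReal (rateConst b La Lb B) * inputCost u u' t (X₀ ω, X₀' ω))
        * ENNReal.ofReal (Real.exp (t * growth (4 * rateConst b La Lb B) u (X₀ ω) (X₀' ω) t))
        ∂P := by
  have hcp := rateConst_pos b La Lb B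
  set c := rateConst b La Lb B with hc
  have hy : Measurable[𝓕 0] fun ω => ⌊growth 1 u (X₀ ω) (X₀' ω) t⌋₊ := by
    have h : Measurable fun q : (Fin K → ℝ≥0) × (Fin K → ℝ≥0) => ⌊growth 1 u q.1 q.2 t⌋₊ :=
      Nat.measurable_floor.comp ((measurable_growth hu).comp (measurable_prodMk_right (y := t)))
    have h' := h.comp (hX₀.prodMk hX₀')
    exact h'
  -- On each slice the growth factor is constant up to `1`, and slices belong to `𝓕 0`, so the
  -- Gronwall inequality holds on each with a deterministic rate.
  set S : ℕ → Set Ω := fun j => G ∩ (fun ω => ⌊growth 1 u (X₀ ω) (X₀' ω) t⌋₊) ⁻¹' {j} with hS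
  have hSm : ∀ j, MeasurableSet[𝓕 0] (S j) := fun j => hG.inter (hy (measurableSet_singleton j))
  have hSU : G = ⋃ j, S j := by
    rw [hS, ← inter_iUnion, ← preimage_iUnion, iUnion_of_singleton, preimage_univ, inter_univ]
  have hSd : Pairwise fun i j => Disjoint (S i) (S j) := fun i j hij => by
    refine Disjoint.mono inter_subset_right inter_subset_right ?_
    exact Disjoint.preimage _ (disjoint_singleton.2 hij)
  have hsum : ∀ f : Ω → ℝ≥0∞, ∫⁻ ω in G, f ω ∂P = ∑' j, ∫⁻ ω in S j, f ω ∂P := fun f => by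
    conv_lhs => rw [hSU]
    exact lintegral_iUnion (fun j => 𝓕.le 0 _ (hSm j)) hSd f
  rw [meanDist, hsum, hsum]
  refine ENNReal.tsum_le_tsum fun j => ?_
  have hm : ∀ ω ∈ S j, growth 1 u (X₀ ω) (X₀' ω) t ≤ j + 1 := fun ω hω => by
    have h := (Nat.lt_floor_add_one (growth 1 u (X₀ ω) (X₀' ω) t)).le
    rwa [show ⌊growth 1 u (X₀ ω) (X₀' ω) t⌋₊ = j from hω.2] at h
  have key := gronwall (Φ := meanDist P X X' (S j)) (t := t) (c := c * (j + 1)) (by positivity)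
    ENNReal.ofReal_ne_top
    (fun s hs => meanDist_le_of_growth_le hr haB hX hX' (𝓕.le 0 _ (hSm j)) hs hm)
    (fun s hs => meanDist_le hN hr haB ha hb hu hu' (hX₀.mono (𝓕.le 0) le_rfl)
      (hX₀'.mono (𝓕.le 0) le_rfl) hX hX' (hSm j) hs hm)
  refine key.trans ?_
  rw [← lintegral_mul_const' _ _ ENNReal.ofReal_ne_top]
  refine setLIntegral_mono' (𝓕.le 0 _ (hSm j)) fun ω hω => ?_
  refine mul_le_mul_right (ENNReal.ofReal_le_ofReal (Real.exp_le_exp.2 ?_)) _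
  have h1 : (j : ℝ) ≤ growth 1 u (X₀ ω) (X₀' ω) t := by
    rw [← show ⌊growth 1 u (X₀ ω) (X₀' ω) t⌋₊ = j from hω.2]
    exact Nat.floor_le (zero_le_one.trans (one_le_growth _ _ _ _))
  have h2 := one_le_growth u (X₀ ω) (X₀' ω) t
  rw [growth_eq_mul]
  -- The growth factor is at least `1` and at least `j`, so `j + 1` is at most twice it. With the
  -- factor `2` from `gronwall`, this gives the `4` in the constant.
  calc 2 * (c * (j + 1)) * t = (2 * c * t) * (j + 1) := by ring
    _ ≤ (2 * c * t) * (2 * growth 1 u (X₀ ω) (X₀' ω) t) := by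
      gcongr
      linarith
    _ = _ := by ring

end Main

end AIMD

theorem proposition4p1 {J K : ℕ} (a b : Fin K → ℝ≥0 × (Fin J → ℝ≥0) → ℝ≥0)
    (ha_bdd : ∀ k, ∃ B : ℝ≥0, ∀ x, a k x ≤ B)
    (ha_lip : ∀ k, ∃ L : ℝ≥0, LipschitzWith L (a k))
    (hb_lip : ∀ k, ∃ L : ℝ≥0, LipschitzWith L (b k)) :
    ∃ A : ℝ, 0 ≤ A ∧
      ∀ (r : Fin K → ℝ), (∀ k, r k ∈ Set.Ioo (0 : ℝ) 1) →
      ∀ (Ω : Type*) [mΩ : MeasurableSpace Ω] (P : Measure Ω) [IsProbabilityMeasure P]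
        (𝓕 : Filtration ℝ≥0 mΩ) (N : Fin K → Ω → Measure (ℝ≥0 × ℝ≥0)),
        AIMD.IsDrivingNoise N 𝓕 P →
      ∀ (u u' : ℝ≥0 → Fin J → ℝ≥0), Continuous u → Continuous u' →
      ∀ (X₀ X₀' : Ω → Fin K → ℝ≥0), Measurable[𝓕 0] X₀ → Measurable[𝓕 0] X₀' →
      ∀ (X X' : ℝ≥0 → Ω → Fin K → ℝ≥0),
        AIMD.IsSolution a b r N 𝓕 P u X₀ X → AIMD.IsSolution a b r N 𝓕 P u' X₀' X' →
      ∀ t : ℝ≥0, ∀ᵐ ω ∂P,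
        condLExp (MeasurableSpace.comap (fun ω' => (X₀ ω', X₀' ω')) inferInstance) P
            (fun ω' => ENNReal.ofReal
              (AIMD.supNorm (fun s => AIMD.vec (X s ω') - AIMD.vec (X' s ω')) t)) ω
          ≤ ENNReal.ofReal
              ((‖AIMD.vec (X₀ ω) - AIMD.vec (X₀' ω)‖
                + ∫ s in Set.Ioc 0 t, AIMD.growth A u (X₀ ω) (X₀' ω) s
                    * AIMD.supNorm (fun v => AIMD.vec (u v) - AIMD.vec (u' v)) s ∂AIMD.leb)
                * Real.exp (t * AIMD.growth A u (X₀ ω) (X₀' ω) t)) := by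
  choose Ba hBa using ha_bdd
  choose La ha using ha_lip
  choose Lb hb using hb_lip
  have haB : ∀ k x, a k x ≤ ∑ k, Ba k := fun k x =>
    (hBa k x).trans (Finset.single_le_sum (fun _ _ => zero_le) (Finset.mem_univ k))
  have hcp := AIMD.rateConst_pos b La Lb (∑ k, Ba k)
  refine ⟨4 * AIMD.rateConst b La Lb (∑ k, Ba k), by positivity, ?_⟩
  intro r hr Ω mΩ P _ 𝓕 N hN u u' hu hu' X₀ X₀' hX₀ hX₀' X X' hX hX' t
  set c := AIMD.rateConst b La Lb (∑ k, Ba k) with hc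
  have hinit : Measurable[𝓕 0] fun ω' => (X₀ ω', X₀' ω') := hX₀.prodMk hX₀'
  have hm0 : MeasurableSpace.comap (fun ω' => (X₀ ω', X₀' ω')) inferInstance ≤ 𝓕 0 :=
    hinit.comap_le
  have hm := hm0.trans (𝓕.le 0)
  set g : (Fin K → ℝ≥0) × (Fin K → ℝ≥0) → ℝ≥0∞ := fun q =>
    (ENNReal.ofReal ‖AIMD.vec q.1 - AIMD.vec q.2‖ + ENNReal.ofReal c * AIMD.inputCost u u' t q)
      * ENNReal.ofReal (Real.exp (t * AIMD.growth (4 * c) u q.1 q.2 t)) with hg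
  have hgm : Measurable g := by
    have h1 : Measurable fun q : (Fin K → ℝ≥0) × (Fin K → ℝ≥0) =>
        ‖AIMD.vec q.1 - AIMD.vec q.2‖ :=
      ((AIMD.continuous_vec.comp continuous_fst).sub
        (AIMD.continuous_vec.comp continuous_snd)).norm.measurable
    have h2 : Measurable fun q : (Fin K → ℝ≥0) × (Fin K → ℝ≥0) =>
        AIMD.growth (4 * c) u q.1 q.2 t := by
      simp_rw [AIMD.growth_eq_mul (4 * c)]
      exact ((AIMD.measurable_growth hu).comp (measurable_prodMk_right (y := t))).const_mul _
    exact (h1.ennreal_ofReal.add ((AIMD.measurable_inputCost hu hu' t).const_mul _)).mul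
      (Real.measurable_exp.comp (h2.const_mul _)).ennreal_ofReal
  have hle : condLExp (MeasurableSpace.comap (fun ω' => (X₀ ω', X₀' ω')) inferInstance) P
      (fun ω' => ENNReal.ofReal
        (AIMD.supNorm (fun s => AIMD.vec (X s ω') - AIMD.vec (X' s ω')) t))
      ≤ᵐ[P] fun ω => g (X₀ ω, X₀' ω) := by
    refine ae_le_of_ae_le_trim (hm := hm) ?_
    -- Both sides are functions of `(X₀, X₀')`, so it suffices to compare their integrals over the
    -- events of `σ(X₀, X₀')`, all of which lie in `𝓕 0`.
    refine ae_le_of_forall_setLIntegral_le_of_sigmaFinite (measurable_condLExp _ _ _) ?_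
    intro G hG _
    have hgω : Measurable[MeasurableSpace.comap (fun ω' => (X₀ ω', X₀' ω')) inferInstance]
        fun ω => g (X₀ ω, X₀' ω) := hgm.comp (comap_measurable _)
    rw [setLIntegral_condLExp_trim hm _ _ hG, setLIntegral_trim hm hgω hG]
    exact AIMD.meanDist_le_lintegral hN hr haB ha hb hu hu' hX₀ hX₀' hX hX' (hm0 _ hG) t
  filter_upwards [hle] with ω hω
  refine hω.trans ?_
  rw [hg, ENNReal.ofReal_mul' (Real.exp_pos _).le]
  refine mul_le_mul_left ?_ _
  rw [ENNReal.ofReal_add (norm_nonneg _) (integral_nonneg fun s => mul_nonneg ?_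
    (AIMD.supNorm_nonneg _ _))]
  · exact add_le_add le_rfl
      (AIMD.ofReal_mul_inputCost_le hu hu' t hcp.le (by linarith) (X₀ ω) (X₀' ω))
  · rw [AIMD.growth_eq_mul]
    exact mul_nonneg (by positivity) (zero_le_one.trans (AIMD.one_le_growth _ _ _ _))
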